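/- Let $q$ be a prime power and let $\mathcal Q$ be the Klein quadric $X_1X_2+X_3X_4+X_5X_6=0$ of $\mathrm{PG}(5,q)$. The planes contained in $\mathcal Q$ form two families, two planes being in the same family if and only if they are equal or share exactly one point. Let $g$ be a plane contained in $\mathcal Q$; call the planes of its family Greek and those of the other family Latin. Consider the following sets of planes. - $\mathcal X$ is a set of $q^6-q^3$ planes disjoint from $g$, each meeting $\mathcal Q$ in a non-degenerate conic, such that every line which is disjoint from $g$, or is contained in $\mathcal Q$ but not in $g$, lies in a plane of $\mathcal X\cup\mathcal Y$. - $\mathcal Y$ is the set of Greek planes distinct from $g$. - $\mathcal Z$ is the set of planes that meet $\mathcal Q$ exactly in a line of $g$. - $\mathcal T$ is the orbit of $S$ under $C$. Here, for a line $\ell$ of $g$, a point $P\in\ell$ and the Latin plane $\pi$ through $\ell$, $S$ is the set of planes $\langle m,n\rangle$ with $m\neq\ell$ a line of $\pi$ through $P$ and $n\ne\ell$ a line of $g$ through $P$. The group $C$ is a group of projectivities of $\mathrm{PG}(5,q)$ that stabilizes $\mathcal Q$ and $g$ and induces on $g$ a Singer cyclic group (a cyclic group acting regularly on the points and on the lines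 of $g$). For every prime power $q$ there are such $g,\ell,P,C,\mathcal X$. Moreover, for every choice of them, there are hyperplanes of $\mathrm{PG}(5,q)$ containing $g$, and every hyperplane $\Gamma$ containing $g$ contains exactly $q^3+2q^2+q-1$ elements of $\mathcal X\cup\mathcal Y\cup\mathcal Z\cup\mathcal T$. -/

import Mathlib

open Module

namespace KleinCover

/-- Subspaces of `PG(5,q)`: the linear subspaces of `F^6`, where `F = GF(q)`.
A subspace of vector dimension `k + 1` has projective dimension `k`. -/
abbrev PG5 (F : Type*) [Field F] := Submodule F (Fin 6 → F)

section
variable {F : Type*} [Field F]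

def IsPoint (W : PG5 F) : Prop := finrank F W = 1
def IsLine (W : PG5 F) : Prop := finrank F W = 2
def IsPlane (W : PG5 F) : Prop := finrank F W = 3
def IsHyperplane (W : PG5 F) : Prop := finrank F W = 5

/-- The quadratic form `X₁X₂ + X₃X₄ + X₅X₆` of the Klein quadric. -/
def kleinForm (x : Fin 6 → F) : F := x 0 * x 1 + x 2 * x 3 + x 4 * x 5

/-- All points of the subspace `W` lie on the Klein quadric. -/
def OnQuadric (W : PG5 F) : Prop := ∀ x ∈ W, kleinForm x = 0

/-- The planes on the Klein quadric form two families; two of them belong to the same family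
iff they coincide or share exactly one point (vector dimension of the intersection `3` or `1`),
and to different families iff they are disjoint or meet in a line (vector dimension `0` or `2`). -/
def SameFamily (α β : PG5 F) : Prop := Odd (finrank F ↥(α ⊓ β))

/-- With the family containing the plane `g` called Greek: `α` is a Greek plane. -/
def IsGreek (g α : PG5 F) : Prop := IsPlane α ∧ OnQuadric α ∧ SameFamily g α

/-- With the family containing the plane `g` called Greek: `α` is a Latin plane. -/
def IsLatin (g α : PG5 F) : Prop := IsPlane α ∧ OnQuadric α ∧ ¬ SameFamily g α

/-- The plane `α` meets the Klein quadric in a non-degenerate conic: the form restricted to `α`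
has no singular point.  (Over a finite field, of any characteristic, a ternary quadratic form
which is zero or splits into two linear factors over the quadratic extension has a rational
singular point, and a non-degenerate one has none.) -/
def MeetsInNondegenerateConic (α : PG5 F) : Prop :=
  IsPlane α ∧
    ∀ x ∈ α, kleinForm x = 0 → (∀ y ∈ α, QuadraticMap.polar kleinForm x y = 0) → x = 0

/-- The set `𝒴`: the Greek planes other than `g`. -/
def familyY (g : PG5 F) : Set (PG5 F) := {α | IsGreek g α ∧ α ≠ g}

/-- The set `𝒵`: the planes meeting the Klein quadric exactly in a line of `g`. -/
def familyZ (g : PG5 F) : Set (PG5 F) :=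
  {α | IsPlane α ∧ ∃ l : PG5 F, IsLine l ∧ l ≤ g ∧ ∀ x, (x ∈ α ∧ kleinForm x = 0) ↔ x ∈ l}

/-- The set `S` attached to a line `l` of `g` and a point `P` of `l`: the planes `⟨m, n⟩`, where
`m ≠ l` is a line through `P` of the Latin plane through `l`, and `n ≠ l` is a line of `g`
through `P`. -/
def starS (g l P : PG5 F) : Set (PG5 F) :=
  {α | ∃ π m n : PG5 F, IsLatin g π ∧ l ≤ π ∧
    IsLine m ∧ P ≤ m ∧ m ≤ π ∧ m ≠ l ∧
    IsLine n ∧ P ≤ n ∧ n ≤ g ∧ n ≠ l ∧ α = m ⊔ n}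

/-- The image of a subspace under an invertible linear map. -/
def move (c : (Fin 6 → F) ≃ₗ[F] (Fin 6 → F)) (W : PG5 F) : PG5 F :=
  W.map (c : (Fin 6 → F) →ₗ[F] (Fin 6 → F))

/-- The set `𝒯`: the orbit of `S` under the group `C`. -/
def familyT (g l P : PG5 F) (C : Subgroup ((Fin 6 → F) ≃ₗ[F] (Fin 6 → F))) : Set (PG5 F) :=
  {α | ∃ c ∈ C, ∃ σ ∈ starS g l P, α = move c σ}

/-- `C` is a group of projectivities (given by linear maps that represent them) which stabilizes
the Klein quadric and its plane `g` and induces on the projective plane `g` a Singer cyclic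
group, that is, a cyclic group acting regularly on the points and on the lines of `g`. -/
structure IsSingerGroup (g : PG5 F) (C : Subgroup ((Fin 6 → F) ≃ₗ[F] (Fin 6 → F))) : Prop where
  quadric : ∀ c ∈ C, ∀ x, kleinForm (c x) = 0 ↔ kleinForm x = 0
  plane : ∀ c ∈ C, move c g = g
  cyclic : ∃ c₀ ∈ C, ∀ c ∈ C, ∃ k : ℤ, ∀ P, IsPoint P → P ≤ g → move c P = move (c₀ ^ k) P
  point_transitive : ∀ P P', IsPoint P → P ≤ g → IsPoint P' → P' ≤ g → ∃ c ∈ C, move c P = P'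
  point_free : ∀ c ∈ C, ∀ P, IsPoint P → P ≤ g → move c P = P →
    ∀ P', IsPoint P' → P' ≤ g → move c P' = P'
  line_transitive : ∀ l l', IsLine l → l ≤ g → IsLine l' → l' ≤ g → ∃ c ∈ C, move c l = l'
  line_free : ∀ c ∈ C, ∀ l, IsLine l → l ≤ g → move c l = l →
    ∀ P', IsPoint P' → P' ≤ g → move c P' = P'

/-- The requirements on the set `𝒳`: it consists of `q^6 - q^3` planes, disjoint from `g` and
meeting the Klein quadric in a non-degenerate conic, which together with the planes of `𝒴` cover
every line that is disjoint from `g` or is a line of the quadric not contained in `g`. -/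
structure IsFamilyX (g : PG5 F) (X : Set (PG5 F)) : Prop where
  card : X.ncard = Nat.card F ^ 6 - Nat.card F ^ 3
  disj : ∀ α ∈ X, Disjoint α g
  conic : ∀ α ∈ X, MeetsInNondegenerateConic α
  covers : ∀ l, IsLine l → (Disjoint l g ∨ (OnQuadric l ∧ ¬ l ≤ g)) →
    ∃ α ∈ X ∪ familyY g, l ≤ α

/-- The data of the construction: a plane `g` on the Klein quadric (whose family is called
Greek), a line `l` of `g`, a point `P` of `l`, a group `C` and a set `X` as above. -/
structure IsDesignData (g l P : PG5 F) (C : Subgroup ((Fin 6 → F) ≃ₗ[F] (Fin 6 → F)))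
    (X : Set (PG5 F)) : Prop where
  plane : IsPlane g
  onQuadric : OnQuadric g
  line : IsLine l
  line_le : l ≤ g
  point : IsPoint P
  point_le : P ≤ l
  singer : IsSingerGroup g C
  familyX : IsFamilyX g X

/-- The set of planes `𝒳 ∪ 𝒴 ∪ 𝒵 ∪ 𝒯`. -/
def design (g l P : PG5 F) (C : Subgroup ((Fin 6 → F) ≃ₗ[F] (Fin 6 → F)))
    (X : Set (PG5 F)) : Set (PG5 F) :=
  X ∪ familyY g ∪ familyZ g ∪ familyT g l P C

end

end KleinCover

/-! Let `⊥` denote the polarity of the quadric and `q = |F|`. Since `g = g^⊥`, a hyperplane `Γ`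
through `g` is `R^⊥` for a point `R = Γ^⊥` of `g`, and a plane `α` lies in `Γ` exactly when `R` lies
in `g ∩ α^⊥`. So the count depends only on how this intersection varies over the design. A plane of
`𝒳` is disjoint from `g` and spans the whole space with it, so it never lies in `Γ`. For a Greek
plane `α ≠ g` the intersection is the point `g ∩ α`, and `q` such planes pass through `R`. For a
plane of `𝒵`, or of the star attached to a line of `g`, the intersection is that line
(`inf_perp_of_mem_planesExactlyOn`, `inf_perp_of_mem_starS`). Each line of `g` carries `q - 1`
planes of `𝒵`, and one star of `q^2` planes because `C` is regular on lines (`exists_familyT_eq`).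
With `q + 1` lines through `R` the total is `q + (q + 1)(q - 1 + q^2)`. The individual counts are
made in coordinates at one flag and transported by isometries (`exists_isometry`).

For existence, let `K` be the cubic extension of `F` and model the quadric as `Tr(xy) = 0` on `K ×
K`, with `g = K × 0`. For `𝒳` take the graphs of `y ↦ β y^q + γ y^(q^2)` with `β + γ^q ≠ 0`: two
`F`-independent values of `y` determine `β` and `γ`, which yields the covering property, and the
form restricted to a graph depends only on `β + γ^q`. The maps `(x, y) ↦ (ωx, ω⁻¹y)` form the group
`C`. -/

namespace KleinCover

/-! ### The polarity of the Klein quadric. -/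

section Form
variable {F : Type*} [Field F]

/-- The polar form of the Klein quadric. -/
def kleinBilin : LinearMap.BilinForm F (Fin 6 → F) :=
  LinearMap.mk₂ F
    (fun x y => x 0 * y 1 + x 1 * y 0 + (x 2 * y 3 + x 3 * y 2) + (x 4 * y 5 + x 5 * y 4))
    (by intros; simp; ring) (by intros; simp; ring) (by intros; simp; ring)
    (by intros; simp; ring)

theorem kleinBilin_apply (x y : Fin 6 → F) : kleinBilin x y =
    x 0 * y 1 + x 1 * y 0 + (x 2 * y 3 + x 3 * y 2) + (x 4 * y 5 + x 5 * y 4) := rfl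

theorem kleinForm_add (x y : Fin 6 → F) :
    kleinForm (x + y) = kleinForm x + kleinForm y + kleinBilin x y := by
  simp only [kleinForm, kleinBilin_apply, Pi.add_apply]; ring

theorem kleinForm_smul (a : F) (x : Fin 6 → F) : kleinForm (a • x) = a ^ 2 * kleinForm x := by
  simp only [kleinForm, Pi.smul_apply, smul_eq_mul]; ring

theorem polar_kleinForm (x y : Fin 6 → F) :
    QuadraticMap.polar kleinForm x y = kleinBilin x y := by
  rw [QuadraticMap.polar, kleinForm_add]; ring

theorem kleinBilin_comm (x y : Fin 6 → F) : kleinBilin x y = kleinBilin y x := by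
  simp only [kleinBilin_apply]; ring

theorem kleinBilin_isRefl : (kleinBilin (F := F)).IsRefl := fun x y h => by
  rw [kleinBilin_comm, h]

theorem eq_zero_of_kleinBilin_eq_zero (x : Fin 6 → F) (h : ∀ y, kleinBilin x y = 0) : x = 0 := by
  ext i
  have h0 := h (Pi.single 0 1)
  have h1 := h (Pi.single 1 1)
  have h2 := h (Pi.single 2 1)
  have h3 := h (Pi.single 3 1)
  have h4 := h (Pi.single 4 1)
  have h5 := h (Pi.single 5 1)
  simp [kleinBilin_apply] at h0 h1 h2 h3 h4 h5
  fin_cases i <;> simp [*]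

theorem kleinBilin_nondegenerate : (kleinBilin (F := F)).Nondegenerate :=
  ⟨fun x h => eq_zero_of_kleinBilin_eq_zero x h,
    fun x h => eq_zero_of_kleinBilin_eq_zero x fun y => by rw [kleinBilin_comm]; exact h y⟩

/-- The image of a subspace under the polarity of the Klein quadric. -/
def perp (W : PG5 F) : PG5 F := kleinBilin.orthogonal W

theorem perp_le {W W' : PG5 F} (h : W ≤ W') : perp W' ≤ perp W :=
  LinearMap.BilinForm.orthogonal_le h

theorem perp_perp (W : PG5 F) : perp (perp W) = W :=
  LinearMap.BilinForm.orthogonal_orthogonal kleinBilin_nondegenerate kleinBilin_isRefl W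

theorem le_perp_comm {W W' : PG5 F} : W ≤ perp W' ↔ W' ≤ perp W := by
  constructor <;> intro h <;> simpa only [perp_perp] using perp_le h

theorem finrank_perp (W : PG5 F) : finrank F (perp W) = 6 - finrank F W := by
  rw [perp, LinearMap.BilinForm.finrank_orthogonal kleinBilin_nondegenerate]
  simp

theorem perp_sup (W W' : PG5 F) : perp (W ⊔ W') = perp W ⊓ perp W' := by
  apply le_antisymm
  · exact le_inf (perp_le le_sup_left) (perp_le le_sup_right)
  · rw [le_perp_comm]
    exact sup_le (le_perp_comm.1 inf_le_left) (le_perp_comm.1 inf_le_right)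

theorem OnQuadric.mono {W W' : PG5 F} (h : OnQuadric W') (hW : W ≤ W') : OnQuadric W :=
  fun x hx => h x (hW hx)

theorem OnQuadric.kleinBilin_eq_zero {W : PG5 F} (h : OnQuadric W) {x y : Fin 6 → F}
    (hx : x ∈ W) (hy : y ∈ W) : kleinBilin x y = 0 := by
  have := kleinForm_add x y
  rwa [h x hx, h y hy, h _ (W.add_mem hx hy), zero_add, zero_add, eq_comm] at this

theorem OnQuadric.le_perp {W : PG5 F} (h : OnQuadric W) : W ≤ perp W :=
  fun _ hx _ hw => h.kleinBilin_eq_zero hw hx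

/-- Total singularity gives one inclusion and `6 - 3 = 3` turns it into an equality. This is what
converts containment in a hyperplane into incidence with a point of the plane. -/
theorem OnQuadric.perp_eq {W : PG5 F} (h : OnQuadric W) (hW : IsPlane W) : perp W = W := by
  refine (Submodule.eq_of_le_of_finrank_eq h.le_perp ?_).symm
  rw [finrank_perp, hW]

theorem OnQuadric.sup {W W' : PG5 F} (h : OnQuadric W) (h' : OnQuadric W') (hp : W' ≤ perp W) :
    OnQuadric (W ⊔ W') := by
  intro x hx
  obtain ⟨u, hu, v, hv, rfl⟩ := Submodule.mem_sup.1 hx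
  rw [kleinForm_add, h u hu, h' v hv, hp hv u hu]
  simp

/-- Two subspaces of the same dimension, one contained in the other, are equal. -/
theorem eq_of_le_of_finrank {W W' : PG5 F} {k : ℕ} (h : W ≤ W') (hW : finrank F W = k)
    (hW' : finrank F W' = k) : W = W' :=
  Submodule.eq_of_le_of_finrank_eq h (hW.trans hW'.symm)

end Form

/-! ### The action of linear maps that preserve the quadric. -/

section Move
variable {F : Type*} [Field F]

theorem mem_move {c : (Fin 6 → F) ≃ₗ[F] (Fin 6 → F)} {W : PG5 F} {x : Fin 6 → F} :
    x ∈ move c W ↔ c.symm x ∈ W := by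
  rw [move, Submodule.mem_map_equiv]

theorem finrank_move (c : (Fin 6 → F) ≃ₗ[F] (Fin 6 → F)) (W : PG5 F) :
    finrank F (move c W) = finrank F W :=
  LinearEquiv.finrank_map_eq c W

theorem move_le_move {c : (Fin 6 → F) ≃ₗ[F] (Fin 6 → F)} {W W' : PG5 F} :
    move c W ≤ move c W' ↔ W ≤ W' :=
  Submodule.map_le_map_iff_of_injective c.injective W W'

theorem move_injective (c : (Fin 6 → F) ≃ₗ[F] (Fin 6 → F)) :
    Function.Injective (move c) :=
  Submodule.map_injective_of_injective c.injective

theorem move_inf (c : (Fin 6 → F) ≃ₗ[F] (Fin 6 → F)) (W W' : PG5 F) :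
    move c (W ⊓ W') = move c W ⊓ move c W' :=
  Submodule.map_inf _ c.injective

theorem move_sup (c : (Fin 6 → F) ≃ₗ[F] (Fin 6 → F)) (W W' : PG5 F) :
    move c (W ⊔ W') = move c W ⊔ move c W' :=
  Submodule.map_sup _ _ _

theorem move_mul (c d : (Fin 6 → F) ≃ₗ[F] (Fin 6 → F)) (W : PG5 F) :
    move (c * d) W = move c (move d W) := by
  ext x; simp only [mem_move]; rfl

theorem move_symm_move (c : (Fin 6 → F) ≃ₗ[F] (Fin 6 → F)) (W : PG5 F) :
    move c.symm (move c W) = W := by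
  ext x; simp [mem_move]

theorem move_move_symm (c : (Fin 6 → F) ≃ₗ[F] (Fin 6 → F)) (W : PG5 F) :
    move c (move c.symm W) = W := by
  ext x; simp [mem_move]

/-- The linear map `c` represents a projectivity that stabilizes the Klein quadric. -/
def PreservesQuadric (c : (Fin 6 → F) ≃ₗ[F] (Fin 6 → F)) : Prop :=
  ∀ x, kleinForm (c x) = 0 ↔ kleinForm x = 0

theorem PreservesQuadric.symm {c : (Fin 6 → F) ≃ₗ[F] (Fin 6 → F)} (h : PreservesQuadric c) :
    PreservesQuadric c.symm := fun x => by
  rw [← h (c.symm x), LinearEquiv.apply_symm_apply]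

variable {c : (Fin 6 → F) ≃ₗ[F] (Fin 6 → F)} (hc : PreservesQuadric c)
include hc

theorem PreservesQuadric.onQuadric {W : PG5 F} (h : OnQuadric W) : OnQuadric (move c W) := by
  intro x hx
  rw [mem_move] at hx
  rw [← hc.symm]
  exact h _ hx

theorem PreservesQuadric.isGreek {g α : PG5 F} (h : IsGreek g α) :
    IsGreek (move c g) (move c α) := by
  refine ⟨(finrank_move c α).trans h.1, hc.onQuadric h.2.1, ?_⟩
  rw [SameFamily, ← move_inf, finrank_move]
  exact h.2.2

theorem PreservesQuadric.isLatin {g α : PG5 F} (h : IsLatin g α) :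
    IsLatin (move c g) (move c α) := by
  refine ⟨(finrank_move c α).trans h.1, hc.onQuadric h.2.1, ?_⟩
  rw [SameFamily, ← move_inf, finrank_move]
  exact h.2.2

theorem PreservesQuadric.move_mem_starS {g l P α : PG5 F} (h : α ∈ starS g l P) :
    move c α ∈ starS (move c g) (move c l) (move c P) := by
  obtain ⟨π, m, n, h1, h2, h3, h4, h5, h6, h7, h8, h9, h10, rfl⟩ := h
  exact ⟨move c π, move c m, move c n, hc.isLatin h1, move_le_move.2 h2,
    (finrank_move c m).trans h3, move_le_move.2 h4, move_le_move.2 h5,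
    fun e => h6 (move_injective c e), (finrank_move c n).trans h7, move_le_move.2 h8,
    move_le_move.2 h9, fun e => h10 (move_injective c e), move_sup c m n⟩

end Move

/-! ### Invariance of the sets to be counted. -/

section Sets
variable {F : Type*} [Field F]

/-- The planes that meet the Klein quadric exactly in the line `l`. -/
def planesExactlyOn (l : PG5 F) : Set (PG5 F) :=
  {α | IsPlane α ∧ ∀ x, (x ∈ α ∧ kleinForm x = 0) ↔ x ∈ l}

/-- The Greek planes through `P`, apart from `g` itself. -/
def greekThrough (g P : PG5 F) : Set (PG5 F) := {α | IsGreek g α ∧ α ≠ g ∧ P ≤ α}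

/-- The lines of `g` through `P`. -/
def linesThrough (g P : PG5 F) : Set (PG5 F) := {l | IsLine l ∧ P ≤ l ∧ l ≤ g}

/-- Two sets of subspaces that `c` and its inverse map into each other have the same size. -/
theorem ncard_eq_of_move {A B : Set (PG5 F)} (c : (Fin 6 → F) ≃ₗ[F] (Fin 6 → F))
    (h : ∀ α ∈ A, move c α ∈ B) (h' : ∀ α ∈ B, move c.symm α ∈ A) : B.ncard = A.ncard := by
  have : B = move c '' A := by
    ext α
    constructor
    · intro hα
      exact ⟨_, h' α hα, move_move_symm c α⟩
    · rintro ⟨β, hβ, rfl⟩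
      exact h β hβ
  rw [this, Set.ncard_image_of_injective _ (move_injective c)]

variable {c : (Fin 6 → F) ≃ₗ[F] (Fin 6 → F)} (hc : PreservesQuadric c)
include hc

theorem PreservesQuadric.move_mem_planesExactlyOn {l α : PG5 F} (h : α ∈ planesExactlyOn l) :
    move c α ∈ planesExactlyOn (move c l) := by
  refine ⟨(finrank_move c α).trans h.1, fun x => ?_⟩
  rw [mem_move, mem_move, ← h.2, hc.symm]

theorem PreservesQuadric.ncard_planesExactlyOn (l : PG5 F) :
    (planesExactlyOn (move c l)).ncard = (planesExactlyOn l).ncard := by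
  refine ncard_eq_of_move c (fun α h => hc.move_mem_planesExactlyOn h) fun α h => ?_
  simpa only [move_symm_move] using hc.symm.move_mem_planesExactlyOn h

theorem PreservesQuadric.ncard_starS (g l P : PG5 F) :
    (starS (move c g) (move c l) (move c P)).ncard = (starS g l P).ncard := by
  refine ncard_eq_of_move c (fun α h => hc.move_mem_starS h) fun α h => ?_
  simpa only [move_symm_move] using hc.symm.move_mem_starS h

theorem PreservesQuadric.move_mem_greekThrough {g P α : PG5 F} (h : α ∈ greekThrough g P) :
    move c α ∈ greekThrough (move c g) (move c P) :=
  ⟨hc.isGreek h.1, fun e => h.2.1 (move_injective c e), move_le_move.2 h.2.2⟩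

theorem PreservesQuadric.ncard_greekThrough (g P : PG5 F) :
    (greekThrough (move c g) (move c P)).ncard = (greekThrough g P).ncard := by
  refine ncard_eq_of_move c (fun α h => hc.move_mem_greekThrough h) fun α h => ?_
  simpa only [move_symm_move] using hc.symm.move_mem_greekThrough h

omit hc in
theorem ncard_linesThrough_move (c : (Fin 6 → F) ≃ₗ[F] (Fin 6 → F)) (g P : PG5 F) :
    (linesThrough (move c g) (move c P)).ncard = (linesThrough g P).ncard := by
  refine ncard_eq_of_move c (fun α h => ?_) fun α h => ?_
  · exact ⟨(finrank_move c α).trans h.1, move_le_move.2 h.2.1, move_le_move.2 h.2.2⟩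
  · refine ⟨(finrank_move _ α).trans h.1, ?_, ?_⟩
    · rw [← move_symm_move c P]; exact move_le_move.2 h.2.1
    · rw [← move_symm_move c g]; exact move_le_move.2 h.2.2

end Sets

/-! ### Explicit counts at a standard flag. -/

section Coordinates
variable {F : Type*} [Field F]

/-- For a subspace cut out by equations, `s` lists the free coordinates, and projection to them is
an isomorphism onto `F^k`. -/
theorem finrank_eq_of_coords {k : ℕ} {W : PG5 F} (s : Fin k → Fin 6)
    (inj : ∀ x ∈ W, (∀ i, x (s i) = 0) → x = 0)
    (surj : ∀ a : Fin k → F, ∃ x ∈ W, ∀ i, x (s i) = a i) : finrank F W = k := by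
  let f : W →ₗ[F] (Fin k → F) := (LinearMap.funLeft F F s).comp W.subtype
  have hf : Function.Bijective f := by
    constructor
    · rw [injective_iff_map_eq_zero]
      intro x hx
      exact Subtype.ext (inj x x.2 fun i => congrFun hx i)
    · intro a
      obtain ⟨x, hx, h⟩ := surj a
      exact ⟨⟨x, hx⟩, funext h⟩
  simpa using (LinearEquiv.ofBijective f hf).finrank_eq

theorem exists_mem_of_coords {k : ℕ} {W : PG5 F} (hW : finrank F W = k) (s : Fin k → Fin 6)
    (inj : ∀ x ∈ W, (∀ i, x (s i) = 0) → x = 0) (a : Fin k → F) :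
    ∃ x ∈ W, ∀ i, x (s i) = a i := by
  let f : W →ₗ[F] (Fin k → F) := (LinearMap.funLeft F F s).comp W.subtype
  have hf : Function.Injective f := by
    rw [injective_iff_map_eq_zero]
    intro x hx
    exact Subtype.ext (inj x x.2 fun i => congrFun hx i)
  obtain ⟨x, hx⟩ :=
    (LinearMap.injective_iff_surjective_of_finrank_eq_finrank (by simp [hW])).1 hf a
  exact ⟨x, x.2, fun i => congrFun hx i⟩

omit [Field F] in
theorem vec_ext {x y : Fin 6 → F} (h0 : x 0 = y 0) (h1 : x 1 = y 1) (h2 : x 2 = y 2)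
    (h3 : x 3 = y 3) (h4 : x 4 = y 4) (h5 : x 5 = y 5) : x = y := by
  ext i; fin_cases i <;> assumption

/-- The point spanned by the first basis vector. -/
def stdPoint : PG5 F where
  carrier := {x | x 1 = 0 ∧ x 2 = 0 ∧ x 3 = 0 ∧ x 4 = 0 ∧ x 5 = 0}
  add_mem' := by simp +contextual
  zero_mem' := by simp
  smul_mem' := by simp +contextual

/-- The line of the Klein quadric in which only the coordinates `X₁` and `X₃` may be nonzero. -/
def stdLine : PG5 F where
  carrier := {x | x 1 = 0 ∧ x 3 = 0 ∧ x 4 = 0 ∧ x 5 = 0}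
  add_mem' := by simp +contextual
  zero_mem' := by simp
  smul_mem' := by simp +contextual

/-- The plane `X₂ = X₄ = X₆ = 0` of the Klein quadric. -/
def stdPlane : PG5 F where
  carrier := {x | x 1 = 0 ∧ x 3 = 0 ∧ x 5 = 0}
  add_mem' := by simp +contextual
  zero_mem' := by simp
  smul_mem' := by simp +contextual

/-- The Latin plane through `stdLine`. -/
def stdLatin : PG5 F where
  carrier := {x | x 1 = 0 ∧ x 3 = 0 ∧ x 4 = 0}
  add_mem' := by simp +contextual
  zero_mem' := by simp
  smul_mem' := by simp +contextual

/-- The lines of `stdLatin` through `stdPoint`, apart from `stdLine`. -/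
def latinLine (s : F) : PG5 F where
  carrier := {x | x 1 = 0 ∧ x 3 = 0 ∧ x 4 = 0 ∧ x 2 = s * x 5}
  add_mem' := by simp +contextual [mul_add]
  zero_mem' := by simp
  smul_mem' := by simp +contextual [mul_left_comm]

/-- The lines of `stdPlane` through `stdPoint`, apart from `stdLine`. -/
def greekLine (t : F) : PG5 F where
  carrier := {x | x 1 = 0 ∧ x 3 = 0 ∧ x 5 = 0 ∧ x 2 = t * x 4}
  add_mem' := by simp +contextual [mul_add]
  zero_mem' := by simp
  smul_mem' := by simp +contextual [mul_left_comm]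

/-- The plane spanned by `latinLine s` and `greekLine t`. -/
def starPlane (s t : F) : PG5 F where
  carrier := {x | x 1 = 0 ∧ x 3 = 0 ∧ x 2 = s * x 5 + t * x 4}
  add_mem' := by
    rintro x y ⟨h1, h2, h3⟩ ⟨h1', h2', h3'⟩
    refine ⟨by simp [*], by simp [*], ?_⟩
    simp only [Pi.add_apply, h3, h3']; ring
  zero_mem' := by simp
  smul_mem' := by
    rintro a x ⟨h1, h2, h3⟩
    refine ⟨by simp [*], by simp [*], ?_⟩
    simp only [Pi.smul_apply, smul_eq_mul, h3]; ring

/-- The planes through `stdLine` which, for `t ≠ 0`, meet the Klein quadric in that line only. -/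
def tangentPlane (t : F) : PG5 F where
  carrier := {x | x 1 = 0 ∧ x 3 = 0 ∧ x 5 = t * x 4}
  add_mem' := by simp +contextual [mul_add]
  zero_mem' := by simp
  smul_mem' := by simp +contextual [mul_left_comm]

/-- The Greek planes through `stdPoint`, apart from `stdPlane`. -/
def greekPlane (t : F) : PG5 F where
  carrier := {x | x 1 = 0 ∧ x 2 = -(t * x 5) ∧ x 4 = t * x 3}
  add_mem' := by
    rintro x y ⟨h1, h2, h3⟩ ⟨h1', h2', h3'⟩
    refine ⟨by simp [*], ?_, ?_⟩
    · simp only [Pi.add_apply, h2, h2']; ring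
    · simp only [Pi.add_apply, h3, h3']; ring
  zero_mem' := by simp
  smul_mem' := by
    rintro a x ⟨h1, h2, h3⟩
    refine ⟨by simp [*], ?_, ?_⟩
    · simp only [Pi.smul_apply, smul_eq_mul, h2]; ring
    · simp only [Pi.smul_apply, smul_eq_mul, h3]; ring

theorem mem_stdPoint {x : Fin 6 → F} :
    x ∈ stdPoint ↔ x 1 = 0 ∧ x 2 = 0 ∧ x 3 = 0 ∧ x 4 = 0 ∧ x 5 = 0 := Iff.rfl

theorem mem_stdLine {x : Fin 6 → F} :
    x ∈ stdLine ↔ x 1 = 0 ∧ x 3 = 0 ∧ x 4 = 0 ∧ x 5 = 0 := Iff.rfl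

theorem mem_stdPlane {x : Fin 6 → F} : x ∈ stdPlane ↔ x 1 = 0 ∧ x 3 = 0 ∧ x 5 = 0 := Iff.rfl

theorem mem_stdLatin {x : Fin 6 → F} : x ∈ stdLatin ↔ x 1 = 0 ∧ x 3 = 0 ∧ x 4 = 0 := Iff.rfl

theorem mem_latinLine {s : F} {x : Fin 6 → F} :
    x ∈ latinLine s ↔ x 1 = 0 ∧ x 3 = 0 ∧ x 4 = 0 ∧ x 2 = s * x 5 := Iff.rfl

theorem mem_greekLine {t : F} {x : Fin 6 → F} :
    x ∈ greekLine t ↔ x 1 = 0 ∧ x 3 = 0 ∧ x 5 = 0 ∧ x 2 = t * x 4 := Iff.rfl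

theorem mem_starPlane {s t : F} {x : Fin 6 → F} :
    x ∈ starPlane s t ↔ x 1 = 0 ∧ x 3 = 0 ∧ x 2 = s * x 5 + t * x 4 := Iff.rfl

theorem mem_tangentPlane {t : F} {x : Fin 6 → F} :
    x ∈ tangentPlane t ↔ x 1 = 0 ∧ x 3 = 0 ∧ x 5 = t * x 4 := Iff.rfl

theorem mem_greekPlane {t : F} {x : Fin 6 → F} :
    x ∈ greekPlane t ↔ x 1 = 0 ∧ x 2 = -(t * x 5) ∧ x 4 = t * x 3 := Iff.rfl

theorem isPoint_stdPoint : IsPoint (stdPoint (F := F)) := by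
  refine finrank_eq_of_coords ![0] ?_ fun a => ⟨![a 0, 0, 0, 0, 0, 0], by simp [mem_stdPoint], ?_⟩
  · rintro x ⟨h1, h2, h3, h4, h5⟩ h
    exact vec_ext (h 0) h1 h2 h3 h4 h5
  · intro i; fin_cases i; rfl

theorem isLine_stdLine : IsLine (stdLine (F := F)) := by
  refine finrank_eq_of_coords ![0, 2] ?_
    fun a => ⟨![a 0, 0, a 1, 0, 0, 0], by simp [mem_stdLine], ?_⟩
  · rintro x ⟨h1, h3, h4, h5⟩ h
    exact vec_ext (h 0) h1 (h 1) h3 h4 h5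
  · intro i; fin_cases i <;> rfl

theorem isPlane_stdPlane : IsPlane (stdPlane (F := F)) := by
  refine finrank_eq_of_coords ![0, 2, 4] ?_
    fun a => ⟨![a 0, 0, a 1, 0, a 2, 0], by simp [mem_stdPlane], ?_⟩
  · rintro x ⟨h1, h3, h5⟩ h
    exact vec_ext (h 0) h1 (h 1) h3 (h 2) h5
  · intro i; fin_cases i <;> rfl

theorem isPlane_stdLatin : IsPlane (stdLatin (F := F)) := by
  refine finrank_eq_of_coords ![0, 2, 5] ?_
    fun a => ⟨![a 0, 0, a 1, 0, 0, a 2], by simp [mem_stdLatin], ?_⟩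
  · rintro x ⟨h1, h3, h5⟩ h
    exact vec_ext (h 0) h1 (h 1) h3 h5 (h 2)
  · intro i; fin_cases i <;> rfl

theorem isLine_latinLine (s : F) : IsLine (latinLine s) := by
  refine finrank_eq_of_coords ![0, 5] ?_
    fun a => ⟨![a 0, 0, s * a 1, 0, 0, a 1], by simp [mem_latinLine], ?_⟩
  · rintro x ⟨h1, h3, h4, h2⟩ h
    have h5 : x 5 = 0 := h 1
    exact vec_ext (h 0) h1 (by simp [h2, h5]) h3 h4 h5
  · intro i; fin_cases i <;> rfl

theorem isLine_greekLine (t : F) : IsLine (greekLine t) := by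
  refine finrank_eq_of_coords ![0, 4] ?_
    fun a => ⟨![a 0, 0, t * a 1, 0, a 1, 0], by simp [mem_greekLine], ?_⟩
  · rintro x ⟨h1, h3, h4, h2⟩ h
    have h5 : x 4 = 0 := h 1
    exact vec_ext (h 0) h1 (by simp [h2, h5]) h3 h5 h4
  · intro i; fin_cases i <;> rfl

theorem isPlane_tangentPlane (t : F) : IsPlane (tangentPlane t) := by
  refine finrank_eq_of_coords ![0, 2, 4] ?_
    fun a => ⟨![a 0, 0, a 1, 0, a 2, t * a 2], by simp [mem_tangentPlane], ?_⟩
  · rintro x ⟨h1, h3, h5⟩ h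
    have h4 : x 4 = 0 := h 2
    exact vec_ext (h 0) h1 (h 1) h3 h4 (by simp [h5, h4])
  · intro i; fin_cases i <;> rfl

theorem isPlane_greekPlane (t : F) : IsPlane (greekPlane t) := by
  refine finrank_eq_of_coords ![0, 3, 5] ?_
    fun a => ⟨![a 0, 0, -(t * a 2), a 1, t * a 1, a 2], by simp [mem_greekPlane], ?_⟩
  · rintro x ⟨h1, h2, h4⟩ h
    have h3 : x 3 = 0 := h 1
    have h5 : x 5 = 0 := h 2
    exact vec_ext (h 0) h1 (by simp [h2, h5]) h3 (by simp [h3, h4]) h5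
  · intro i; fin_cases i <;> rfl

theorem stdPoint_le_stdLine : stdPoint (F := F) ≤ stdLine :=
  fun _ ⟨h1, _, h3, h4, h5⟩ => ⟨h1, h3, h4, h5⟩

theorem stdLine_le_stdPlane : stdLine (F := F) ≤ stdPlane :=
  fun _ ⟨h1, h3, _, h5⟩ => ⟨h1, h3, h5⟩

theorem single_mem_stdPoint : (![1, 0, 0, 0, 0, 0] : Fin 6 → F) ∈ stdPoint := by
  simp [mem_stdPoint]

theorem latinLine_sup_greekLine (s t : F) : latinLine s ⊔ greekLine t = starPlane s t := by
  apply le_antisymm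
  · refine sup_le ?_ ?_
    · rintro x ⟨h1, h3, h4, h2⟩
      exact ⟨h1, h3, by simp [h4, h2]⟩
    · rintro x ⟨h1, h3, h4, h2⟩
      exact ⟨h1, h3, by simp [h4, h2]⟩
  · rintro x ⟨h1, h3, h2⟩
    refine Submodule.mem_sup.2 ⟨![x 0, 0, s * x 5, 0, 0, x 5], by simp [mem_latinLine],
      ![0, 0, t * x 4, 0, x 4, 0], by simp [mem_greekLine], ?_⟩
    apply vec_ext <;> simp [*]

theorem starPlane_injective : Function.Injective fun p : F × F => starPlane p.1 p.2 := by
  rintro ⟨s, t⟩ ⟨s', t'⟩ h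
  simp only at h
  have h1 : (![0, 0, s, 0, 0, 1] : Fin 6 → F) ∈ starPlane s' t' := by
    rw [← h]; simp [mem_starPlane]
  have h2 : (![0, 0, t, 0, 1, 0] : Fin 6 → F) ∈ starPlane s' t' := by
    rw [← h]; simp [mem_starPlane]
  simp [mem_starPlane] at h1 h2
  rw [h1, h2]

theorem tangentPlane_injective : Function.Injective (tangentPlane (F := F)) := by
  intro t t' h
  have h1 : (![0, 0, 0, 0, 1, t] : Fin 6 → F) ∈ tangentPlane t' := by
    rw [← h]; simp [mem_tangentPlane]
  simpa [mem_tangentPlane] using h1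

theorem greekPlane_injective : Function.Injective (greekPlane (F := F)) := by
  intro t t' h
  have h1 : (![0, 0, 0, 1, t, 0] : Fin 6 → F) ∈ greekPlane t' := by
    rw [← h]; simp [mem_greekPlane]
  simpa [mem_greekPlane] using h1

theorem greekLine_injective : Function.Injective (greekLine (F := F)) := by
  intro t t' h
  have h1 : (![0, 0, t, 0, 1, 0] : Fin 6 → F) ∈ greekLine t' := by
    rw [← h]; simp [mem_greekLine]
  simpa [mem_greekLine] using h1

theorem stdLine_ne_greekLine (t : F) : stdLine ≠ greekLine t := by
  intro h
  have h1 : (![0, 0, t, 0, 1, 0] : Fin 6 → F) ∈ stdLine := by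
    rw [h]; simp [mem_greekLine]
  simp [mem_stdLine] at h1

theorem stdLine_ne_latinLine (s : F) : stdLine ≠ latinLine s := by
  intro h
  have h1 : (![0, 0, s, 0, 0, 1] : Fin 6 → F) ∈ stdLine := by
    rw [h]; simp [mem_latinLine]
  simp [mem_stdLine] at h1

theorem stdPoint_le_greekLine (t : F) : stdPoint ≤ greekLine t :=
  fun _ ⟨h1, h2, h3, h4, h5⟩ => ⟨h1, h3, h5, by simp [h2, h4]⟩

theorem stdPoint_le_latinLine (s : F) : stdPoint ≤ latinLine s :=
  fun _ ⟨h1, h2, h3, h4, h5⟩ => ⟨h1, h3, h4, by simp [h2, h5]⟩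

theorem greekLine_le_stdPlane (t : F) : greekLine t ≤ stdPlane :=
  fun _ ⟨h1, h3, h5, _⟩ => ⟨h1, h3, h5⟩

/-- A line of `stdPlane` through `stdPoint` is `stdLine` or one of the lines `greekLine t`. -/
theorem eq_greekLine_of_le {n : PG5 F} (hn : IsLine n) (hP : stdPoint ≤ n) (hg : n ≤ stdPlane)
    (hne : n ≠ stdLine) : ∃ t, n = greekLine t := by
  obtain ⟨w, hw, hw4⟩ : ∃ w ∈ n, w 4 ≠ 0 := by
    by_contra! h
    refine hne (eq_of_le_of_finrank ?_ hn isLine_stdLine)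
    intro x hx
    obtain ⟨h1, h3, h5⟩ := hg hx
    exact ⟨h1, h3, h x hx, h5⟩
  obtain ⟨h1, h3, h5⟩ := hg hw
  refine ⟨w 2 / w 4, (eq_of_le_of_finrank ?_ (isLine_greekLine _) hn).symm⟩
  rintro x ⟨k1, k3, k5, k2⟩
  have : x = (x 0 - x 4 / w 4 * w 0) • ![1, 0, 0, 0, 0, 0] + (x 4 / w 4) • w := by
    apply vec_ext <;> (simp [*]; try field_simp)
  rw [this]
  exact n.add_mem (n.smul_mem _ (hP single_mem_stdPoint)) (n.smul_mem _ hw)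

theorem eq_latinLine_of_le {m : PG5 F} (hm : IsLine m) (hP : stdPoint ≤ m) (hg : m ≤ stdLatin)
    (hne : m ≠ stdLine) : ∃ s, m = latinLine s := by
  obtain ⟨w, hw, hw4⟩ : ∃ w ∈ m, w 5 ≠ 0 := by
    by_contra! h
    refine hne (eq_of_le_of_finrank ?_ hm isLine_stdLine)
    intro x hx
    obtain ⟨h1, h3, h5⟩ := hg hx
    exact ⟨h1, h3, h5, h x hx⟩
  obtain ⟨h1, h3, h5⟩ := hg hw
  refine ⟨w 2 / w 5, (eq_of_le_of_finrank ?_ (isLine_latinLine _) hm).symm⟩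
  rintro x ⟨k1, k3, k5, k2⟩
  have : x = (x 0 - x 5 / w 5 * w 0) • ![1, 0, 0, 0, 0, 0] + (x 5 / w 5) • w := by
    apply vec_ext <;> (simp [*]; try field_simp)
  rw [this]
  exact m.add_mem (m.smul_mem _ (hP single_mem_stdPoint)) (m.smul_mem _ hw)

/-- A Latin plane meets `g` in a line as soon as it contains a line of `g`. -/
theorem IsLatin.inf_eq {g l π : PG5 F} (hg : IsPlane g) (hl : IsLine l) (hlg : l ≤ g)
    (h : IsLatin g π) (hlπ : l ≤ π) : g ⊓ π = l := by
  have h1 : finrank F l ≤ finrank F ↥(g ⊓ π) := Submodule.finrank_mono (le_inf hlg hlπ)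
  have h2 : finrank F ↥(g ⊓ π) ≤ finrank F g := Submodule.finrank_mono inf_le_left
  have h3 : finrank F ↥(g ⊓ π) = 2 := by
    have h4 := h.2.2
    rw [SameFamily, Nat.not_odd_iff_even] at h4
    rw [hl] at h1
    rw [hg] at h2
    obtain ⟨k, hk⟩ := h4
    omega
  exact (eq_of_le_of_finrank (le_inf hlg hlπ) hl h3).symm

theorem isLatin_stdLatin : IsLatin (stdPlane (F := F)) stdLatin := by
  refine ⟨isPlane_stdLatin, ?_, ?_⟩
  · rintro x ⟨h1, h3, h4⟩
    simp [kleinForm, h1, h3, h4]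
  · have : stdPlane ⊓ stdLatin = stdLine (F := F) := by
      ext x
      simp only [Submodule.mem_inf, mem_stdPlane, mem_stdLatin, mem_stdLine]
      tauto
    rw [SameFamily, this, isLine_stdLine]
    decide

/-- The polar space of `stdLine` is `X₂ = X₄ = 0`, where the form reduces to `X₅X₆`. Hence a quadric
plane through the line lies in the union of `stdPlane` and `stdLatin`, and its points in `stdPlane`
already belong to the line. -/
theorem IsLatin.eq_stdLatin {π : PG5 F} (h : IsLatin stdPlane π) (hl : stdLine ≤ π) :
    π = stdLatin := by
  have hinf := h.inf_eq isPlane_stdPlane isLine_stdLine stdLine_le_stdPlane hl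
  refine eq_of_le_of_finrank ?_ h.1 isPlane_stdLatin
  intro x hx
  have h1 : x 1 = 0 := by
    have := h.2.1.kleinBilin_eq_zero (hl (stdPoint_le_stdLine single_mem_stdPoint)) hx
    simpa [kleinBilin_apply] using this
  have h3 : x 3 = 0 := by
    have hm : (![0, 0, 1, 0, 0, 0] : Fin 6 → F) ∈ stdLine := by simp [mem_stdLine]
    have := h.2.1.kleinBilin_eq_zero (hl hm) hx
    simpa [kleinBilin_apply] using this
  have hQ := h.2.1 x hx
  simp only [kleinForm, h1, h3, mul_zero, zero_add, mul_eq_zero] at hQ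
  rcases hQ with h4 | h5
  · exact ⟨h1, h3, h4⟩
  · have : x ∈ stdLine := by
      rw [← hinf]; exact ⟨⟨h1, h3, h5⟩, hx⟩
    exact ⟨h1, h3, this.2.2.1⟩

theorem starS_std : starS stdPlane stdLine stdPoint =
    Set.range fun p : F × F => starPlane p.1 p.2 := by
  ext α
  constructor
  · rintro ⟨π, m, n, hπ, hlπ, hm, hPm, hmπ, hml, hn, hPn, hng, hnl, rfl⟩
    obtain rfl := hπ.eq_stdLatin hlπ
    obtain ⟨s, rfl⟩ := eq_latinLine_of_le hm hPm hmπ hml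
    obtain ⟨t, rfl⟩ := eq_greekLine_of_le hn hPn hng hnl
    exact ⟨(s, t), (latinLine_sup_greekLine s t).symm⟩
  · rintro ⟨⟨s, t⟩, rfl⟩
    exact ⟨stdLatin, latinLine s, greekLine t, isLatin_stdLatin, fun x hx => ⟨hx.1, hx.2.1, hx.2.2.1⟩,
      isLine_latinLine s, stdPoint_le_latinLine s, fun x hx => ⟨hx.1, hx.2.1, hx.2.2.1⟩,
      (stdLine_ne_latinLine s).symm, isLine_greekLine t, stdPoint_le_greekLine t,
      greekLine_le_stdPlane t, (stdLine_ne_greekLine t).symm, (latinLine_sup_greekLine s t).symm⟩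

theorem ncard_starS_std : (starS stdPlane stdLine (stdPoint (F := F))).ncard = Nat.card F ^ 2 := by
  rw [starS_std, ← Set.image_univ, Set.ncard_image_of_injective _ starPlane_injective,
    Set.ncard_univ, Nat.card_prod, sq]

theorem linesThrough_std : linesThrough stdPlane stdPoint =
    insert stdLine (Set.range (greekLine (F := F))) := by
  ext n
  constructor
  · rintro ⟨hn, hP, hg⟩
    by_cases h : n = stdLine
    · exact Or.inl h
    · obtain ⟨t, rfl⟩ := eq_greekLine_of_le hn hP hg h
      exact Or.inr ⟨t, rfl⟩
  · rintro (rfl | ⟨t, rfl⟩)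
    · exact ⟨isLine_stdLine, stdPoint_le_stdLine, stdLine_le_stdPlane⟩
    · exact ⟨isLine_greekLine t, stdPoint_le_greekLine t, greekLine_le_stdPlane t⟩

theorem ncard_linesThrough_std [Finite F] :
    (linesThrough stdPlane (stdPoint (F := F))).ncard = Nat.card F + 1 := by
  rw [linesThrough_std, Set.ncard_insert_of_notMem, ← Set.image_univ,
    Set.ncard_image_of_injective _ greekLine_injective, Set.ncard_univ]
  rintro ⟨t, ht⟩
  exact stdLine_ne_greekLine t ht.symm

/-- A plane meeting the quadric exactly in the line `l` lies in the polar space of `l`. -/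
theorem kleinBilin_eq_zero_of_mem_planesExactlyOn {l α : PG5 F} (h : α ∈ planesExactlyOn l)
    {x y : Fin 6 → F} (hx : x ∈ l) (hy : y ∈ α) : kleinBilin x y = 0 := by
  obtain ⟨hxα, hQx⟩ := (h.2 x).2 hx
  by_contra hb
  -- If `x` and `y` were not orthogonal, the line joining them would carry a singular point other
  -- than `x`, namely this one. It has to lie in `l`, which forces `y` into `l` as well.
  have hy' : y + (-(kleinForm y / kleinBilin x y)) • x ∈ l := by
    refine (h.2 _).1 ⟨α.add_mem hy (α.smul_mem _ hxα), ?_⟩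
    rw [kleinForm_add, kleinForm_smul, hQx, map_smul, smul_eq_mul, kleinBilin_comm y x]
    field_simp
    ring
  have hyl : y ∈ l := by
    have := l.sub_mem hy' (l.smul_mem (-(kleinForm y / kleinBilin x y)) hx)
    simpa using this
  have hl : OnQuadric l := fun z hz => ((h.2 z).2 hz).2
  exact hb (hl.kleinBilin_eq_zero hx hyl)

/-- Such a plane lies in the polar space `X₂ = X₄ = 0` of the line. In the pencil of planes between
the two, `X₅ = 0` and `X₆ = 0` lie on the quadric; on each other one the form is `t X₅²` with `t ≠
0`. -/
theorem planesExactlyOn_stdLine : planesExactlyOn stdLine =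
    tangentPlane '' {t : F | t ≠ 0} := by
  ext α
  constructor
  · intro hα
    have hle : stdLine ≤ α := fun x hx => ((hα.2 x).2 hx).1
    have h1 : ∀ x ∈ α, x 1 = 0 := by
      intro x hx
      have := kleinBilin_eq_zero_of_mem_planesExactlyOn hα
        (stdPoint_le_stdLine single_mem_stdPoint) hx
      simpa [kleinBilin_apply] using this
    have he : (![0, 0, 1, 0, 0, 0] : Fin 6 → F) ∈ stdLine := by simp [mem_stdLine]
    have h3 : ∀ x ∈ α, x 3 = 0 := by
      intro x hx
      have := kleinBilin_eq_zero_of_mem_planesExactlyOn hα he hx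
      simpa [kleinBilin_apply] using this
    obtain ⟨v, hv, hvl⟩ : ∃ v ∈ α, v ∉ stdLine := by
      by_contra! h
      have h2 : finrank F α ≤ finrank F (stdLine (F := F)) := Submodule.finrank_mono h
      rw [hα.1, isLine_stdLine] at h2
      omega
    have hQ : kleinForm v ≠ 0 := fun h => hvl ((hα.2 v).1 ⟨hv, h⟩)
    have hv1 := h1 v hv
    have hv3 := h3 v hv
    simp only [kleinForm, hv1, hv3, mul_zero, zero_add, mul_eq_zero, ne_eq, not_or] at hQ
    obtain ⟨h4, h5⟩ := hQ
    refine ⟨v 5 / v 4, div_ne_zero h5 h4,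
      eq_of_le_of_finrank ?_ (isPlane_tangentPlane _) hα.1⟩
    rintro x ⟨k1, k3, k5⟩
    have : x = (x 0 - x 4 / v 4 * v 0) • ![1, 0, 0, 0, 0, 0] +
        (x 2 - x 4 / v 4 * v 2) • ![0, 0, 1, 0, 0, 0] + (x 4 / v 4) • v := by
      apply vec_ext <;> (simp [*]; try field_simp)
    rw [this]
    exact α.add_mem (α.add_mem
      (α.smul_mem _ (hle (stdPoint_le_stdLine single_mem_stdPoint)))
      (α.smul_mem _ (hle he))) (α.smul_mem _ hv)
  · rintro ⟨t, ht, rfl⟩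
    refine ⟨isPlane_tangentPlane t, fun x => ?_⟩
    rw [mem_tangentPlane, mem_stdLine]
    constructor
    · rintro ⟨⟨h1, h3, h5⟩, hQ⟩
      have h4 : x 4 = 0 := by
        simpa [kleinForm, h1, h3, h5, show t ≠ 0 from ht] using hQ
      exact ⟨h1, h3, h4, by rw [h5, h4, mul_zero]⟩
    · rintro ⟨h1, h3, h4, h5⟩
      simp [kleinForm, *]

theorem ncard_planesExactlyOn_std [Finite F] :
    (planesExactlyOn (stdLine (F := F))).ncard = Nat.card F - 1 := by
  rw [planesExactlyOn_stdLine, Set.ncard_image_of_injective _ tangentPlane_injective]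
  have : {t : F | t ≠ 0} = {0}ᶜ := rfl
  rw [this, Set.ncard_compl, Set.ncard_singleton]

theorem stdPlane_inf_greekPlane (t : F) : stdPlane ⊓ greekPlane t = stdPoint := by
  ext x
  simp only [Submodule.mem_inf, mem_stdPlane, mem_greekPlane, mem_stdPoint]
  constructor
  · rintro ⟨⟨h1, h3, h5⟩, -, h2, h4⟩
    simp [*]
  · rintro ⟨h1, h2, h3, h4, h5⟩
    simp [*]

theorem onQuadric_greekPlane (t : F) : OnQuadric (greekPlane t) := by
  rintro x ⟨h1, h2, h4⟩
  simp only [kleinForm, h1, h2, h4]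
  ring

theorem greekPlane_mem (t : F) : greekPlane t ∈ greekThrough stdPlane stdPoint := by
  refine ⟨⟨isPlane_greekPlane t, onQuadric_greekPlane t, ?_⟩, ?_, ?_⟩
  · rw [SameFamily, stdPlane_inf_greekPlane, isPoint_stdPoint]
    decide
  · intro h
    have := stdPlane_inf_greekPlane t
    rw [h, inf_idem] at this
    have h1 := isPlane_stdPlane (F := F)
    rw [this, IsPlane, isPoint_stdPoint] at h1
    omega
  · rw [← stdPlane_inf_greekPlane t]; exact inf_le_right

theorem IsGreek.finrank_inf {g α : PG5 F} (hg : IsPlane g) (h : IsGreek g α) (hne : α ≠ g) :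
    finrank F ↥(g ⊓ α) = 1 := by
  have h1 : finrank F ↥(g ⊓ α) ≤ finrank F g := Submodule.finrank_mono inf_le_left
  obtain ⟨k, hk⟩ := h.2.2
  rw [hg] at h1
  have h3 : finrank F ↥(g ⊓ α) ≠ 3 := by
    intro h3
    have e1 := eq_of_le_of_finrank inf_le_left h3 hg
    have e2 := eq_of_le_of_finrank inf_le_right h3 h.1
    exact hne (e2.symm.trans e1)
  omega

/-- Meeting `stdPlane` only in the point makes `X₁, X₄, X₆` coordinates on the plane. In the basis
with these unit coordinates, total singularity leaves a single skew parameter: `v 2 = u 4 = 0` and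
`u 2 = -v 4`. -/
theorem greekThrough_std : greekThrough stdPlane stdPoint =
    Set.range (greekPlane (F := F)) := by
  ext α
  constructor
  · rintro ⟨hα, hne, hP⟩
    have he : (![1, 0, 0, 0, 0, 0] : Fin 6 → F) ∈ α := hP single_mem_stdPoint
    have h1 : ∀ x ∈ α, x 1 = 0 := by
      intro x hx
      have := hα.2.1.kleinBilin_eq_zero he hx
      simpa [kleinBilin_apply] using this
    have hinf : stdPlane ⊓ α = stdPoint :=
      (eq_of_le_of_finrank (le_inf (stdPoint_le_stdLine.trans stdLine_le_stdPlane) hP)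
        isPoint_stdPoint (hα.finrank_inf isPlane_stdPlane hne)).symm
    have key := exists_mem_of_coords hα.1 ![0, 3, 5] (by
      intro x hx h
      have hx' : x ∈ stdPoint := by
        rw [← hinf]; exact ⟨⟨h1 x hx, h 1, h 2⟩, hx⟩
      obtain ⟨k1, k2, k3, k4, k5⟩ := hx'
      exact vec_ext (h 0) k1 k2 k3 k4 k5)
    obtain ⟨v, hv, kv⟩ := key ![0, 1, 0]
    obtain ⟨u, hu, ku⟩ := key ![0, 0, 1]
    have v0 : v 0 = 0 := kv 0
    have v3 : v 3 = 1 := kv 1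
    have v5 : v 5 = 0 := kv 2
    have u0 : u 0 = 0 := ku 0
    have u3 : u 3 = 0 := ku 1
    have u5 : u 5 = 1 := ku 2
    have v1 := h1 v hv
    have u1 := h1 u hu
    have v2 : v 2 = 0 := by simpa [kleinForm, *] using hα.2.1 v hv
    have u4 : u 4 = 0 := by simpa [kleinForm, *] using hα.2.1 u hu
    have uv : u 2 + v 4 = 0 := by
      have := hα.2.1.kleinBilin_eq_zero hu hv
      rw [kleinBilin_apply, u0, u1, u3, u4, u5, v1, v2, v3] at this
      linear_combination this
    have u2 : u 2 = - v 4 := eq_neg_of_add_eq_zero_left uv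
    refine ⟨v 4, eq_of_le_of_finrank ?_ (isPlane_greekPlane _) hα.1⟩
    rintro x ⟨k1, k2, k4⟩
    have : x = x 0 • ![1, 0, 0, 0, 0, 0] + x 3 • v + x 5 • u := by
      apply vec_ext <;> simp only [Pi.add_apply, Pi.smul_apply, smul_eq_mul] <;>
        simp [v0, v1, v2, v3, v5, u0, u1, u2, u3, u4, u5, k1, k2, k4, mul_comm]
    rw [this]
    exact α.add_mem (α.add_mem (α.smul_mem _ he) (α.smul_mem _ hv)) (α.smul_mem _ hu)
  · rintro ⟨t, rfl⟩
    exact greekPlane_mem t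

theorem ncard_greekThrough_std :
    (greekThrough stdPlane (stdPoint (F := F))).ncard = Nat.card F := by
  rw [greekThrough_std, ← Set.image_univ, Set.ncard_image_of_injective _ greekPlane_injective,
    Set.ncard_univ]

end Coordinates

/-! ### Transitivity on flags of the quadric. -/

section Witt
variable {F : Type*} [Field F]

/-- Independence gives a linear left inverse of `a ↦ Σ aᵢ eᵢ`; nondegeneracy of the polar form
represents its coordinate functionals by vectors. -/
theorem exists_dual_vectors (e : Fin 3 → Fin 6 → F) (he : LinearIndependent F e) :
    ∃ f : Fin 3 → Fin 6 → F, ∀ i j, kleinBilin (e i) (f j) = if i = j then 1 else 0 := by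
  rw [linearIndependent_iff_injective_fintypeLinearCombination] at he
  obtain ⟨r, hr⟩ := LinearMap.exists_leftInverse_of_injective (Fintype.linearCombination F e)
    (LinearMap.ker_eq_bot.2 he)
  refine ⟨fun j => (kleinBilin.toDual kleinBilin_nondegenerate).symm
    ((LinearMap.proj j).comp r), fun i j => ?_⟩
  rw [kleinBilin_comm, LinearMap.BilinForm.apply_toDual_symm_apply, LinearMap.comp_apply]
  have h := LinearMap.congr_fun hr (Pi.single i 1)
  rw [LinearMap.comp_apply, Fintype.linearCombination_apply_single, one_smul] at h
  rw [h]
  simp [Pi.single_apply, eq_comm]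

/-- A basis of a totally singular plane extends to a hyperbolic basis of the whole space. -/
theorem exists_hyperbolic_vectors {g : PG5 F} (hg : OnQuadric g) (e : Fin 3 → Fin 6 → F)
    (he : LinearIndependent F e) (heg : ∀ i, e i ∈ g) :
    ∃ f : Fin 3 → Fin 6 → F, (∀ i j, kleinBilin (e i) (f j) = if i = j then 1 else 0) ∧
      (∀ i, kleinForm (f i) = 0) ∧ kleinBilin (f 0) (f 1) = 0 ∧ kleinBilin (f 0) (f 2) = 0 ∧
      kleinBilin (f 1) (f 2) = 0 := by
  obtain ⟨f, hf⟩ := exists_dual_vectors e he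
  have hQ : ∀ i, kleinForm (e i) = 0 := fun i => hg _ (heg i)
  have hB : ∀ i j, kleinBilin (e i) (e j) = 0 := fun i j => hg.kleinBilin_eq_zero (heg i) (heg j)
  have hf' : ∀ i j, kleinBilin (f j) (e i) = if i = j then 1 else 0 := fun i j => by
    rw [kleinBilin_comm, hf]
  -- A Gram–Schmidt correction by vectors of `g`, valid in every characteristic: the multiple of `e
  -- i` makes `f i` singular, and the multiples of `e j` with `j > i` remove the products with the
  -- later `f j`.
  refine ⟨![f 0 + (-kleinForm (f 0)) • e 0 + (-kleinBilin (f 0) (f 1)) • e 1 +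
      (-kleinBilin (f 0) (f 2)) • e 2,
    f 1 + (-kleinForm (f 1)) • e 1 + (-kleinBilin (f 1) (f 2)) • e 2,
    f 2 + (-kleinForm (f 2)) • e 2], ?_, ?_, ?_, ?_, ?_⟩
  · intro i j
    fin_cases j <;> simp [hB, hf]
  · intro i
    have hQs : ∀ (a : F) i, kleinForm (-(a • e i)) = 0 := fun a i =>
      hg _ (g.neg_mem (g.smul_mem _ (heg i)))
    fin_cases i <;> simp [kleinForm_add, hQs, hB, hf']
  all_goals simp [hB, hf, hf']

/-- The matrix with the hyperbolic basis as columns preserves the form. It is injective because a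
kernel vector is orthogonal to everything. -/
theorem exists_isometry_of_basis {g : PG5 F} (hg : OnQuadric g) (e : Fin 3 → Fin 6 → F)
    (he : LinearIndependent F e) (heg : ∀ i, e i ∈ g) :
    ∃ c : (Fin 6 → F) ≃ₗ[F] (Fin 6 → F), (∀ x, kleinForm (c x) = kleinForm x) ∧
      ∀ a b d, c ![a, 0, b, 0, d, 0] = a • e 0 + b • e 1 + d • e 2 := by
  obtain ⟨f, hf, hQ, h01, h02, h12⟩ := exists_hyperbolic_vectors hg e he heg
  have hQe : ∀ i, kleinForm (e i) = 0 := fun i => hg _ (heg i)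
  have hB : ∀ i j, kleinBilin (e i) (e j) = 0 := fun i j => hg.kleinBilin_eq_zero (heg i) (heg j)
  have hf' : ∀ i j, kleinBilin (f j) (e i) = if i = j then 1 else 0 := fun i j => by
    rw [kleinBilin_comm, hf]
  let L := Fintype.linearCombination F ![e 0, f 0, e 1, f 1, e 2, f 2]
  have hL : ∀ x, L x = x 0 • e 0 + x 1 • f 0 + x 2 • e 1 + x 3 • f 1 + x 4 • e 2 + x 5 • f 2 := by
    intro x
    rw [Fintype.linearCombination_apply, Fin.sum_univ_six]
    rfl
  have hLQ : ∀ x, kleinForm (L x) = kleinForm x := by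
    intro x
    rw [hL]
    simp only [kleinForm_add, kleinForm_smul, hB, hf, hf', hQ, hQe, map_add, map_smul,
      LinearMap.add_apply, LinearMap.smul_apply, smul_eq_mul, h01, h02, h12]
    simp [kleinForm]
    ring
  have hinj : Function.Injective L := by
    rw [injective_iff_map_eq_zero]
    intro x hx
    apply eq_zero_of_kleinBilin_eq_zero
    intro y
    have h1 := kleinForm_add x y
    rw [← hLQ, ← hLQ x, ← hLQ y, map_add, hx] at h1
    simpa [kleinForm] using h1
  refine ⟨LinearEquiv.ofInjectiveEndo L hinj, fun x => hLQ x, fun a b d => ?_⟩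
  rw [LinearEquiv.coe_ofInjectiveEndo, hL]
  simp

/-- The isometries of the Klein quadric are transitive on the flags consisting of a point, a line
and a plane of the quadric. -/
theorem exists_isometry {g l P : PG5 F} (hg : IsPlane g) (hQ : OnQuadric g) (hl : IsLine l)
    (hlg : l ≤ g) (hP : IsPoint P) (hPl : P ≤ l) :
    ∃ c : (Fin 6 → F) ≃ₗ[F] (Fin 6 → F), PreservesQuadric c ∧ move c stdPlane = g ∧
      move c stdLine = l ∧ move c stdPoint = P := by
  have exists_notMem : ∀ {U W : PG5 F}, finrank F U < finrank F W → ∃ x ∈ W, x ∉ U := by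
    intro U W h
    by_contra! h'
    exact absurd (Submodule.finrank_mono h' : finrank F W ≤ finrank F U) (not_le.2 h)
  obtain ⟨e0, he0, h0⟩ := exists_notMem (U := ⊥) (W := P) (by rw [hP, finrank_bot]; norm_num)
  obtain ⟨e1, he1, h1⟩ := exists_notMem (U := P) (W := l) (by rw [hP, hl]; norm_num)
  obtain ⟨e2, he2, h2⟩ := exists_notMem (U := l) (W := g) (by rw [hg, hl]; norm_num)
  have hli : LinearIndependent F ![e0, e1, e2] := by
    rw [Fintype.linearIndependent_iff]
    intro a ha
    simp only [Fin.sum_univ_three, Matrix.cons_val] at ha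
    have a2 : a 2 = 0 := by
      by_contra hne
      refine h2 ?_
      have : a 2 • e2 = -(a 0 • e0 + a 1 • e1) := eq_neg_of_add_eq_zero_right ha
      rw [← l.smul_mem_iff hne, this]
      exact l.neg_mem (l.add_mem (l.smul_mem _ (hPl he0)) (l.smul_mem _ he1))
    rw [a2, zero_smul, add_zero] at ha
    have a1 : a 1 = 0 := by
      by_contra hne
      refine h1 ?_
      rw [← P.smul_mem_iff hne, eq_neg_of_add_eq_zero_right ha]
      exact P.neg_mem (P.smul_mem _ he0)
    rw [a1, zero_smul, add_zero] at ha
    have a0 : a 0 = 0 := by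
      by_contra hne
      exact h0 ((Submodule.mem_bot F).2 ((smul_eq_zero.1 ha).resolve_left hne))
    intro i
    fin_cases i <;> assumption
  obtain ⟨c, hc, hce⟩ := exists_isometry_of_basis hQ ![e0, e1, e2] hli (by
    intro i
    fin_cases i
    exacts [hlg (hPl he0), hlg he1, he2])
  refine ⟨c, fun x => by rw [hc], ?_, ?_, ?_⟩
  · refine eq_of_le_of_finrank ?_ ((finrank_move c _).trans isPlane_stdPlane) hg
    rintro _ ⟨x, ⟨k1, k3, k5⟩, rfl⟩
    have : x = ![x 0, 0, x 2, 0, x 4, 0] := vec_ext rfl k1 rfl k3 rfl k5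
    rw [this]
    change c _ ∈ g
    rw [hce]
    exact g.add_mem (g.add_mem (g.smul_mem _ (hlg (hPl he0))) (g.smul_mem _ (hlg he1)))
      (g.smul_mem _ he2)
  · refine eq_of_le_of_finrank ?_ ((finrank_move c _).trans isLine_stdLine) hl
    rintro _ ⟨x, ⟨k1, k3, k4, k5⟩, rfl⟩
    have : x = ![x 0, 0, x 2, 0, 0, 0] := vec_ext rfl k1 rfl k3 k4 k5
    rw [this]
    change c _ ∈ l
    rw [hce, zero_smul, add_zero]
    exact l.add_mem (l.smul_mem _ (hPl he0)) (l.smul_mem _ he1)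
  · refine eq_of_le_of_finrank ?_ ((finrank_move c _).trans isPoint_stdPoint) hP
    rintro _ ⟨x, ⟨k1, k2, k3, k4, k5⟩, rfl⟩
    have : x = ![x 0, 0, 0, 0, 0, 0] := vec_ext rfl k1 k2 k3 k4 k5
    rw [this]
    change c _ ∈ P
    rw [hce, zero_smul, zero_smul, add_zero, add_zero]
    exact P.smul_mem _ he0

theorem exists_isLine_between {g P : PG5 F} (hg : IsPlane g) (hP : IsPoint P) (hPg : P ≤ g) :
    ∃ l, IsLine l ∧ P ≤ l ∧ l ≤ g := by
  obtain ⟨v, hv, hvP⟩ : ∃ v ∈ g, v ∉ P := by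
    by_contra! h
    have h2 : finrank F g ≤ finrank F P := Submodule.finrank_mono h
    rw [hg, hP] at h2
    omega
  refine ⟨P ⊔ F ∙ v, ?_, le_sup_left, sup_le hPg ((Submodule.span_singleton_le_iff_mem _ _).2 hv)⟩
  rw [IsLine, Submodule.finrank_sup_span_singleton hvP, hP]

theorem exists_isPoint_le {l : PG5 F} (hl : IsLine l) : ∃ P, IsPoint P ∧ P ≤ l := by
  obtain ⟨v, hv, hne⟩ := l.exists_mem_ne_zero_of_ne_bot (by
    rintro rfl
    rw [IsLine, finrank_bot] at hl
    omega)
  exact ⟨F ∙ v, finrank_span_singleton hne, (Submodule.span_singleton_le_iff_mem _ _).2 hv⟩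

end Witt

/-! ### Counting the planes of the design in a hyperplane through `g`. -/

section Counting
variable {F : Type*} [Field F] {g l P : PG5 F}

theorem ncard_starS (hg : IsPlane g) (hQ : OnQuadric g) (hl : IsLine l)
    (hlg : l ≤ g) (hP : IsPoint P) (hPl : P ≤ l) : (starS g l P).ncard = Nat.card F ^ 2 := by
  obtain ⟨c, hc, rfl, rfl, rfl⟩ := exists_isometry hg hQ hl hlg hP hPl
  rw [hc.ncard_starS, ncard_starS_std]

theorem ncard_planesExactlyOn [Finite F] (hg : IsPlane g) (hQ : OnQuadric g) (hl : IsLine l)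
    (hlg : l ≤ g) : (planesExactlyOn l).ncard = Nat.card F - 1 := by
  obtain ⟨P, hP, hPl⟩ := exists_isPoint_le hl
  obtain ⟨c, hc, rfl, rfl, rfl⟩ := exists_isometry hg hQ hl hlg hP hPl
  rw [hc.ncard_planesExactlyOn, ncard_planesExactlyOn_std]

theorem ncard_greekThrough (hg : IsPlane g) (hQ : OnQuadric g) (hP : IsPoint P) (hPg : P ≤ g) :
    (greekThrough g P).ncard = Nat.card F := by
  obtain ⟨l, hl, hPl, hlg⟩ := exists_isLine_between hg hP hPg
  obtain ⟨c, hc, rfl, rfl, rfl⟩ := exists_isometry hg hQ hl hlg hP hPl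
  rw [hc.ncard_greekThrough, ncard_greekThrough_std]

theorem ncard_linesThrough [Finite F] (hg : IsPlane g) (hQ : OnQuadric g) (hP : IsPoint P)
    (hPg : P ≤ g) : (linesThrough g P).ncard = Nat.card F + 1 := by
  obtain ⟨l, hl, hPl, hlg⟩ := exists_isLine_between hg hP hPg
  obtain ⟨c, hc, rfl, rfl, rfl⟩ := exists_isometry hg hQ hl hlg hP hPl
  rw [ncard_linesThrough_move, ncard_linesThrough_std]

/-- A subspace `W` between a line `l` and a plane `g` is one of them. -/
theorem eq_or_eq_of_le_of_le {W : PG5 F} (hg : IsPlane g) (hl : IsLine l) (h1 : l ≤ W)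
    (h2 : W ≤ g) : W = l ∨ W = g := by
  have k1 : finrank F l ≤ finrank F W := Submodule.finrank_mono h1
  have k2 : finrank F W ≤ finrank F g := Submodule.finrank_mono h2
  rw [hl] at k1
  rw [hg] at k2
  rcases (by omega : finrank F W = 2 ∨ finrank F W = 3) with h | h
  · exact Or.inl (eq_of_le_of_finrank h1 hl h).symm
  · exact Or.inr (eq_of_le_of_finrank h2 h hg)

/-- The plane is orthogonal to `l`, so only `l` or `g` is possible. If it were `g`, then `α ≤ g^⊥ =
g` would be totally singular and so contained in `l`. -/
theorem inf_perp_of_mem_planesExactlyOn {α : PG5 F} (hg : IsPlane g) (hQ : OnQuadric g)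
    (hl : IsLine l) (hlg : l ≤ g) (h : α ∈ planesExactlyOn l) : g ⊓ perp α = l := by
  refine (eq_or_eq_of_le_of_le hg hl (le_inf hlg ?_) inf_le_left).resolve_right ?_
  · intro x hx y hy
    rw [kleinBilin_comm]
    exact kleinBilin_eq_zero_of_mem_planesExactlyOn h hx hy
  · intro he
    have h1 : α ≤ g := by
      rw [← hQ.perp_eq hg, le_perp_comm]
      exact inf_eq_left.1 he
    have h2 : α ≤ l := fun x hx => (h.2 x).1 ⟨hx, hQ x (h1 hx)⟩
    have h3 : finrank F α ≤ finrank F l := Submodule.finrank_mono h2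
    rw [h.1, hl] at h3
    omega

theorem inf_perp_of_mem_starS {α : PG5 F} (hg : IsPlane g) (hQ : OnQuadric g)
    (hl : IsLine l) (hlg : l ≤ g) (h : α ∈ starS g l P) : g ⊓ perp α = l := by
  obtain ⟨π, m, n, hπ, hlπ, hm, hPm, hmπ, hml, hn, hPn, hng, hnl, rfl⟩ := h
  -- The line `n` imposes no condition, because `n ≤ g` gives `g ≤ n^⊥`.
  have h1 : g ⊓ perp (m ⊔ n) = g ⊓ perp m := by
    rw [perp_sup, inf_comm (perp m), ← inf_assoc,
      inf_eq_left.2 (hQ.le_perp.trans (perp_le hng))]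
  rw [h1]
  refine (eq_or_eq_of_le_of_le hg hl (le_inf hlg ?_) inf_le_left).resolve_right ?_
  · exact hlπ.trans (hπ.2.1.le_perp.trans (perp_le hmπ))
  -- All of `g` would force `m ≤ g^⊥ = g`, hence `m ≤ g ⊓ π = l`, against `m ≠ l`.
  · intro he
    have h1 : m ≤ g := by
      rw [← hQ.perp_eq hg, le_perp_comm]
      exact inf_eq_left.1 he
    refine hml (eq_of_le_of_finrank ?_ hm hl)
    rw [← hπ.inf_eq hg hl hlg hlπ]
    exact le_inf h1 hmπ

theorem disjoint_planesExactlyOn_starS (hQ : OnQuadric g) (hl : IsLine l) :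
    Disjoint (planesExactlyOn l) (starS g l P) := by
  rw [Set.disjoint_left]
  rintro _ h ⟨π, m, n, hπ, hlπ, hm, hPm, hmπ, hml, hn, hPn, hng, hnl, rfl⟩
  refine hnl (eq_of_le_of_finrank (fun x hx => ?_) hn hl)
  exact (h.2 x).1 ⟨le_sup_right (a := m) hx, hQ x (hng hx)⟩

instance [Finite F] : Finite (PG5 F) :=
  Finite.of_injective (fun W : PG5 F => (W : Set (Fin 6 → F))) SetLike.coe_injective

/-- The number of planes associated with the lines of `g` through a point, when a star is attached
to every line of `g`. -/
theorem ncard_greekThrough_union [Finite F] (hg : IsPlane g) (hQ : OnQuadric g) (hP : IsPoint P)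
    (hPg : P ≤ g) (p : PG5 F → PG5 F) (hp : ∀ l, IsLine l → l ≤ g → IsPoint (p l) ∧ p l ≤ l) :
    (greekThrough g P ∪ ⋃ l ∈ linesThrough g P, (planesExactlyOn l ∪ starS g l (p l))).ncard =
      Nat.card F ^ 3 + 2 * Nat.card F ^ 2 + Nat.card F - 1 := by
  -- The line is recovered from the plane as `g ∩ α^⊥`. This makes the sets for different lines
  -- disjoint, and the dimension (`2` against `1`) separates them from the Greek planes.
  have key : ∀ l, IsLine l → l ≤ g → ∀ α ∈ planesExactlyOn l ∪ starS g l (p l),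
      g ⊓ perp α = l := by
    rintro l hl hlg α (h | h)
    · exact inf_perp_of_mem_planesExactlyOn hg hQ hl hlg h
    · exact inf_perp_of_mem_starS hg hQ hl hlg h
  rw [Set.ncard_union_eq, ncard_greekThrough hg hQ hP hPg,
    (Set.toFinite (linesThrough g P)).ncard_biUnion (fun _ _ => Set.toFinite _)]
  · have h1 : ∀ l ∈ linesThrough g P, (planesExactlyOn l ∪ starS g l (p l)).ncard =
        Nat.card F - 1 + Nat.card F ^ 2 := by
      rintro l ⟨hl, hPl, hlg⟩
      obtain ⟨h1, h2⟩ := hp l hl hlg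
      rw [Set.ncard_union_eq (disjoint_planesExactlyOn_starS hQ hl),
        ncard_planesExactlyOn hg hQ hl hlg, ncard_starS hg hQ hl hlg h1 h2]
    rw [finsum_mem_congr rfl h1, finsum_mem_eq_finite_toFinset_sum _ (Set.toFinite _),
      Finset.sum_const, ← Set.ncard_eq_toFinset_card, ncard_linesThrough hg hQ hP hPg]
    -- Writing `q = k + 1` removes the truncated subtraction in `q - 1`; the outer one becomes an
    -- additive identity.
    obtain ⟨k, hk⟩ : ∃ k, Nat.card F = k + 1 := ⟨_, (Nat.succ_pred Nat.card_pos.ne').symm⟩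
    rw [hk, smul_eq_mul, Nat.add_sub_cancel]
    symm
    apply Nat.sub_eq_of_eq_add
    ring
  · intro l ⟨hl, _, hlg⟩ l' ⟨hl', _, hlg'⟩ hne
    rw [Function.onFun, Set.disjoint_left]
    intro α h h'
    exact hne ((key l hl hlg α h).symm.trans (key l' hl' hlg' α h'))
  · rw [Set.disjoint_left]
    rintro α ⟨hα, hne, -⟩ h
    simp only [Set.mem_iUnion] at h
    obtain ⟨l, ⟨hl, _, hlg⟩, h⟩ := h
    have h1 := key l hl hlg α h
    rw [hα.2.1.perp_eq hα.1] at h1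
    have h2 := hα.finrank_inf hg hne
    rw [h1, hl] at h2
    omega

theorem move_symm_eq {c : (Fin 6 → F) ≃ₗ[F] (Fin 6 → F)} {W W' : PG5 F} (h : move c W = W') :
    move c.symm W' = W := by
  rw [← h, move_symm_move]

/-- The orbit of a star under a Singer group consists of one star for every line of `g`. -/
theorem exists_familyT_eq {C : Subgroup ((Fin 6 → F) ≃ₗ[F] (Fin 6 → F))} (hl : IsLine l)
    (hlg : l ≤ g) (hP : IsPoint P) (hPl : P ≤ l) (hC : IsSingerGroup g C) :
    ∃ p : PG5 F → PG5 F, (∀ l, IsLine l → l ≤ g → IsPoint (p l) ∧ p l ≤ l) ∧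
      ∀ α, α ∈ familyT g l P C ↔ ∃ l', IsLine l' ∧ l' ≤ g ∧ α ∈ starS g l' (p l') := by
  have hmove : ∀ c ∈ C, ∀ α ∈ starS g l P, move c α ∈ starS g (move c l) (move c P) := by
    intro c hc α hα
    have h := PreservesQuadric.move_mem_starS (hC.quadric c hc) hα
    rwa [hC.plane c hc] at h
  have hex : ∀ l', IsLine l' → l' ≤ g → ∃ c ∈ C, move c l = l' :=
    fun l' h h' => hC.line_transitive l l' hl hlg h h'
  choose! γ hγC hγ using hex
  refine ⟨fun l' => move (γ l') P, fun l' h h' => ⟨(finrank_move _ _).trans hP, ?_⟩, fun α => ?_⟩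
  · simpa only [hγ l' h h'] using move_le_move (c := γ l').2 hPl
  constructor
  · rintro ⟨c, hc, σ, hσ, rfl⟩
    have hlc : IsLine (move c l) := (finrank_move c l).trans hl
    have hlcg : move c l ≤ g := by
      simpa only [hC.plane c hc] using move_le_move (c := c).2 hlg
    refine ⟨move c l, hlc, hlcg, ?_⟩
    -- The chosen `γ (move c l)` and `c` differ by an element fixing `l`. Regularity on lines makes
    -- it fix `P` too, so the vertex of the star over a line does not depend on the group element
    -- used.
    have h1 : move ((γ (move c l))⁻¹ * c) l = l := by
      rw [move_mul]
      exact move_symm_eq (hγ _ hlc hlcg)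
    have h2 := hC.line_free _ (C.mul_mem (C.inv_mem (hγC _ hlc hlcg)) hc) l hl hlg h1 P hP
      (hPl.trans hlg)
    have h3 : move (γ (move c l)) P = move c P := by
      conv_lhs => rw [← h2, ← move_mul, mul_inv_cancel_left]
    simp only [h3]
    exact hmove c hc σ hσ
  · rintro ⟨l', hl', hlg', hα⟩
    have hc := hγC l' hl' hlg'
    refine ⟨γ l', hc, move (γ l').symm α, ?_, (move_move_symm _ _).symm⟩
    have h := PreservesQuadric.move_mem_starS (PreservesQuadric.symm (hC.quadric _ hc)) hα
    rwa [move_symm_eq (hC.plane _ hc), move_symm_eq (hγ l' hl' hlg'), move_symm_move] at h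

theorem ncard_design_hyperplane [Finite F] {C : Subgroup ((Fin 6 → F) ≃ₗ[F] (Fin 6 → F))}
    {X : Set (PG5 F)} (h : IsDesignData g l P C X) {Γ : PG5 F} (hΓ : IsHyperplane Γ)
    (hgΓ : g ≤ Γ) : {α ∈ design g l P C X | α ≤ Γ}.ncard =
      Nat.card F ^ 3 + 2 * Nat.card F ^ 2 + Nat.card F - 1 := by
  have hg := h.plane
  have hQ := h.onQuadric
  obtain ⟨p, hp, hT⟩ := exists_familyT_eq h.line h.line_le h.point h.point_le h.singer
  have hR : IsPoint (perp Γ) := by rw [IsPoint, finrank_perp, hΓ]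
  have hRg : perp Γ ≤ g := by rw [← hQ.perp_eq hg]; exact perp_le hgΓ
  -- The polarity turns containment in `Γ` into incidence of the point `Γ^⊥` with `g ∩ α^⊥`.
  have hle : ∀ α, α ≤ Γ ↔ perp Γ ≤ g ⊓ perp α := fun α => by
    rw [le_inf_iff, and_iff_right hRg, le_perp_comm, perp_perp]
  rw [← ncard_greekThrough_union hg hQ hR hRg p hp]
  congr 1
  ext α
  simp only [Set.mem_union, Set.mem_iUnion, design, Set.mem_ofPred_eq]
  constructor
  · rintro ⟨((hα | hα) | hα) | hα, hαΓ⟩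
    -- A plane disjoint from `g` spans dimension `6` together with it, too much for `Γ`.
    · exfalso
      have h1 := h.familyX.disj α hα
      have h2 := Submodule.finrank_sup_add_finrank_inf_eq α g
      have h3 : finrank F ↥(α ⊔ g) ≤ finrank F Γ := Submodule.finrank_mono (sup_le hαΓ hgΓ)
      rw [disjoint_iff.1 h1, finrank_bot, (h.familyX.conic α hα).1, hg] at h2
      rw [hΓ] at h3
      omega
    · refine Or.inl ⟨hα.1, hα.2, ?_⟩
      rw [← hα.1.2.1.perp_eq hα.1.1]
      exact perp_le hαΓ
    · obtain ⟨h1, m, hm, hmg, h2⟩ := hα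
      refine Or.inr ⟨m, ⟨hm, ?_, hmg⟩, Or.inl ⟨h1, h2⟩⟩
      rwa [← inf_perp_of_mem_planesExactlyOn hg hQ hm hmg ⟨h1, h2⟩, ← hle]
    · obtain ⟨m, hm, hmg, h2⟩ := (hT α).1 hα
      refine Or.inr ⟨m, ⟨hm, ?_, hmg⟩, Or.inr h2⟩
      rwa [← inf_perp_of_mem_starS hg hQ hm hmg h2, ← hle]
  · rintro (⟨h1, h2, h3⟩ | ⟨m, ⟨hm, hRm, hmg⟩, h1 | h1⟩)
    · refine ⟨Or.inl (Or.inl (Or.inr ⟨h1, h2⟩)), ?_⟩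
      rw [hle, h1.2.1.perp_eq h1.1]
      exact le_inf hRg h3
    · refine ⟨Or.inl (Or.inr ⟨h1.1, m, hm, hmg, h1.2⟩), ?_⟩
      rwa [hle, inf_perp_of_mem_planesExactlyOn hg hQ hm hmg h1]
    · refine ⟨Or.inr ((hT α).2 ⟨m, hm, hmg, h1⟩), ?_⟩
      rwa [hle, inf_perp_of_mem_starS hg hQ hm hmg h1]

theorem exists_isHyperplane_ge (hg : IsPlane g) (hQ : OnQuadric g) :
    ∃ Γ : PG5 F, IsHyperplane Γ ∧ g ≤ Γ := by
  obtain ⟨v, hv, hne⟩ := g.exists_mem_ne_zero_of_ne_bot (by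
    rintro rfl
    rw [IsPlane, finrank_bot] at hg
    omega)
  refine ⟨perp (F ∙ v), ?_, ?_⟩
  · rw [IsHyperplane, finrank_perp, finrank_span_singleton hne]
  · rw [le_perp_comm, hQ.perp_eq hg]
    exact (Submodule.span_singleton_le_iff_mem _ _).2 hv

end Counting

/-! ### Lines of the quadric and Greek planes. -/

section Cover
variable {F : Type*} [Field F] {g l : PG5 F}

theorem latinLine_le_greekPlane (s : F) : latinLine s ≤ greekPlane (-s) := by
  rintro x ⟨h1, h3, h4, h2⟩
  exact ⟨h1, by rw [h2]; ring, by rw [h3, h4, mul_zero]⟩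

/-- Every line of the Klein quadric outside `g` lies in a Greek plane other than `g`. -/
theorem exists_familyY_ge (hg : IsPlane g) (hQ : OnQuadric g) (hl : IsLine l)
    (hlQ : OnQuadric l) (hlg : ¬ l ≤ g) : ∃ α ∈ familyY g, l ≤ α := by
  have h1 : finrank F ↥(g ⊓ l) ≤ finrank F l := Submodule.finrank_mono inf_le_right
  have h2 : finrank F ↥(g ⊓ l) ≠ 2 := fun h =>
    hlg (inf_eq_right.1 (eq_of_le_of_finrank inf_le_right h hl))
  have hpl : finrank F (perp l) = 4 := by rw [finrank_perp, hl]
  have hdim := Submodule.finrank_sup_add_finrank_inf_eq g (perp l)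
  rw [hl] at h1
  rw [hg, hpl] at hdim
  rcases (by omega : finrank F ↥(g ⊓ l) = 0 ∨ finrank F ↥(g ⊓ l) = 1) with h0 | h0
  -- For `l` disjoint from `g`, the space `g ∩ l^⊥` has dimension at least `3 + 4 - 6 = 1`. Joining
  -- `l` to one of its points gives a quadric plane meeting `g` in that point alone.
  · rw [Submodule.finrank_eq_zero] at h0
    have h3 : finrank F ↥(g ⊔ perp l) ≤ 6 := by
      simpa using Submodule.finrank_le (g ⊔ perp l)
    obtain ⟨p, hp, hne⟩ := (g ⊓ perp l).exists_mem_ne_zero_of_ne_bot (by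
      intro h
      rw [h, finrank_bot] at hdim
      omega)
    have hpl : p ∉ l := fun h => hne (by
      have : p ∈ g ⊓ l := ⟨hp.1, h⟩
      rwa [h0, Submodule.mem_bot] at this)
    have hpg : F ∙ p ≤ g := (Submodule.span_singleton_le_iff_mem _ _).2 hp.1
    have hinf : g ⊓ (l ⊔ F ∙ p) = F ∙ p := by
      rw [inf_comm, sup_comm, sup_inf_assoc_of_le l hpg, inf_comm, h0, sup_bot_eq]
    have hodd : SameFamily g (l ⊔ F ∙ p) := by
      rw [SameFamily, hinf, finrank_span_singleton hne]
      decide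
    refine ⟨l ⊔ F ∙ p, ⟨⟨?_, ?_, hodd⟩, ?_⟩, le_sup_left⟩
    · rw [IsPlane, Submodule.finrank_sup_span_singleton hpl, hl]
    · exact hlQ.sup (hQ.mono hpg) ((Submodule.span_singleton_le_iff_mem _ _).2 hp.2)
    · rintro rfl
      exact hlg le_sup_left
  -- If `l` meets `g` in a point, then `g ∩ l^⊥` is a line, since `g` and `l^⊥` both lie in the
  -- hyperplane polar to that point. With `l` it spans a Latin plane; after a move to the standard
  -- flag `l` is some `latinLine s`, which a known Greek plane contains.
  · have hPg : g ⊓ l ≤ g := inf_le_left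
    have h3 : finrank F ↥(g ⊔ perp l) ≤ finrank F (perp (g ⊓ l)) :=
      Submodule.finrank_mono (sup_le (hQ.le_perp.trans (perp_le inf_le_left))
        (perp_le inf_le_right))
    rw [finrank_perp, h0] at h3
    have h4 : finrank F ↥(g ⊓ perp l) ≤ finrank F g := Submodule.finrank_mono inf_le_left
    have h5 : finrank F ↥(g ⊓ perp l) ≠ 3 := fun h => hlg (by
      rw [← hQ.perp_eq hg, le_perp_comm]
      exact inf_eq_left.1 (eq_of_le_of_finrank inf_le_left h hg))
    rw [hg] at h4
    have hn : IsLine (g ⊓ perp l) := by rw [IsLine]; omega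
    have hPn : g ⊓ l ≤ g ⊓ perp l := inf_le_inf_left _ hlQ.le_perp
    have hinf : l ⊓ (g ⊓ perp l) = g ⊓ l :=
      le_antisymm (le_inf (inf_le_right.trans inf_le_left) inf_le_left) (le_inf inf_le_right hPn)
    have hπ : IsPlane (l ⊔ g ⊓ perp l) := by
      have := Submodule.finrank_sup_add_finrank_inf_eq l (g ⊓ perp l)
      rw [hinf, h0, hn, hl] at this
      rw [IsPlane]; omega
    have hgπ : g ⊓ (l ⊔ g ⊓ perp l) = g ⊓ perp l :=
      (eq_or_eq_of_le_of_le hg hn (le_inf inf_le_left le_sup_right) inf_le_left).resolve_right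
        fun h => hlg (by
          have := eq_of_le_of_finrank (inf_eq_left.1 h) hg hπ
          rw [this]
          exact le_sup_left)
    have hL : IsLatin g (l ⊔ g ⊓ perp l) := by
      refine ⟨hπ, hlQ.sup (hQ.mono inf_le_left) inf_le_right, ?_⟩
      rw [SameFamily, hgπ, hn]
      decide
    obtain ⟨c, hc, hcg, hcl, hcP⟩ := exists_isometry hg hQ hn inf_le_left h0 hPn
    have hL' := hc.symm.isLatin hL
    rw [move_symm_eq hcg] at hL'
    have hs := hL'.eq_stdLatin (by
      rw [← move_symm_eq hcl]
      exact move_le_move.2 le_sup_right)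
    obtain ⟨s, hs'⟩ := eq_latinLine_of_le (m := move c.symm l) ((finrank_move _ _).trans hl)
      (by rw [← move_symm_eq hcP]; exact move_le_move.2 inf_le_right)
      (by rw [← hs]; exact move_le_move.2 le_sup_left)
      (by
        rw [← move_symm_eq hcl]
        intro h
        exact hlg (((move_injective _ h).le).trans inf_le_left))
    have hgr := hc.move_mem_greekThrough (greekPlane_mem (-s))
    rw [hcg] at hgr
    refine ⟨_, ⟨hgr.1, hgr.2.1⟩, ?_⟩
    rw [← move_move_symm c l, hs']
    exact move_le_move.2 (latinLine_le_greekPlane s)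

end Cover

/-! ### The model `Tr(xy) = 0` and the construction of `𝒳`. -/

section CubicExtension

/-- A finite field has a cubic extension, with its Frobenius automorphism. -/
theorem exists_cubic_extension (F : Type*) [Field F] [Finite F] :
    ∃ (K : Type) (_ : Field K) (_ : Finite K) (_ : Algebra F K) (σ : K ≃ₐ[F] K),
      finrank F K = 3 ∧ (∀ x, σ (σ (σ x)) = x) ∧
      (∀ x, algebraMap F K (Algebra.trace F K x) = x + σ x + σ (σ x)) ∧
      ∀ x, σ x = x → ∃ a, algebraMap F K a = x := by
  obtain ⟨p, hp⟩ := CharP.exists F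
  have : Fact p.Prime := ⟨CharP.char_is_prime F p⟩
  let K := FiniteField.Extension F p 3
  have h3 : finrank F K = 3 := FiniteField.finrank_extension F p 3
  have hσ : ∀ x : K, FiniteField.Extension.frob F p 3 x = x ^ Nat.card F :=
    fun x => FiniteField.Extension.frob_apply F p 3
  refine ⟨K, inferInstance, inferInstance, inferInstance, FiniteField.Extension.frob F p 3, h3,
    ?_, ?_, ?_⟩
  · intro x
    have hx : x ^ (Nat.card F ^ 3) = x := by
      have := Fintype.ofFinite K
      rw [← FiniteField.natCard_extension F p 3, Nat.card_eq_fintype_card]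
      exact FiniteField.pow_card x
    rw [hσ, hσ, hσ, ← pow_mul, ← pow_mul]
    convert hx using 2
    ring
  · intro x
    rw [FiniteField.algebraMap_trace_eq_sum_pow, h3, Finset.sum_range_succ,
      Finset.sum_range_succ, Finset.sum_range_one, hσ, hσ]
    rw [pow_zero, pow_one, pow_one, ← pow_mul, sq]
  · intro x hx
    have hgal : IsGalois F K := inferInstance
    -- The Frobenius generates the Galois group, so an element it fixes is fixed by the whole group.
    have := (IsGalois.mem_range_algebraMap_iff_fixed (F := F) (E := K) x).2 fun f => by
      obtain ⟨i, -, rfl⟩ := FiniteField.Extension.exists_frob_pow_eq F p 3 f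
      induction i with
      | zero => rfl
      | succ i ih => rw [pow_succ, AlgEquiv.mul_apply, hx, ih]
    exact this

variable {F K : Type*} [Field F] [Field K] [Algebra F K] [Finite F] [Finite K]

theorem eq_zero_of_trace_mul_eq_zero {x : K} (h : ∀ y, Algebra.trace F K (x * y) = 0) :
    x = 0 :=
  (traceForm_nondegenerate F K).1 x h

/-- The Klein quadric is the quadric `Tr(xy) = 0` of `K × K`, for a cubic extension `K`. -/
theorem exists_trace_model (h3 : finrank F K = 3) :
    ∃ Φ : (K × K) ≃ₗ[F] (Fin 6 → F), ∀ u, kleinForm (Φ u) = Algebra.trace F K (u.1 * u.2) := by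
  let b := finBasisOfFinrankEq F K h3
  -- In trace-dual bases `Tr(xy)` is `Σ xᵢyᵢ`; interleaving the coordinates of the two factors
  -- yields the Klein form.
  let b' := (Algebra.traceForm F K).dualBasis (traceForm_nondegenerate F K) b
  have hbb : ∀ i j, Algebra.trace F K (b i * b' j) = if i = j then 1 else 0 := by
    intro i j
    exact (Algebra.traceForm F K).apply_dualBasis_right (traceForm_nondegenerate F K)
      (Algebra.traceForm_isSymm F) b i j
  let f : (K × K) →ₗ[F] (Fin 6 → F) :=
    { toFun := fun u => ![b.repr u.1 0, b'.repr u.2 0, b.repr u.1 1, b'.repr u.2 1,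
        b.repr u.1 2, b'.repr u.2 2]
      map_add' := fun u v => by simp
      map_smul' := fun a u => by simp }
  have hinj : Function.Injective f := by
    rw [injective_iff_map_eq_zero]
    rintro ⟨x, y⟩ h
    have hx : b.repr x = 0 := by
      ext i
      fin_cases i
      exacts [congrFun h 0, congrFun h 2, congrFun h 4]
    have hy : b'.repr y = 0 := by
      ext i
      fin_cases i
      exacts [congrFun h 1, congrFun h 3, congrFun h 5]
    rw [LinearEquiv.map_eq_zero_iff] at hx hy
    rw [hx, hy]; rfl
  have hsurj : Function.Surjective f :=
    (LinearMap.injective_iff_surjective_of_finrank_eq_finrank (by simp [h3])).1 hinj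
  refine ⟨LinearEquiv.ofBijective f ⟨hinj, hsurj⟩, fun u => ?_⟩
  have hf : LinearEquiv.ofBijective f ⟨hinj, hsurj⟩ u = ![b.repr u.1 0, b'.repr u.2 0,
    b.repr u.1 1, b'.repr u.2 1, b.repr u.1 2, b'.repr u.2 2] := rfl
  rw [hf]
  conv_rhs => rw [← b.sum_repr u.1, ← b'.sum_repr u.2]
  simp only [Fin.sum_univ_three, add_mul, mul_add, smul_mul_smul_comm, map_add, map_smul, hbb]
  simp [kleinForm]

/-- The `q`-polynomial `y ↦ β y^q + γ y^(q^2)`, as a linear map. -/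
def qPoly (σ : K ≃ₐ[F] K) (β γ : K) : K →ₗ[F] K :=
  LinearMap.mulLeft F β ∘ₗ σ.toLinearMap + LinearMap.mulLeft F γ ∘ₗ (σ.toLinearMap ∘ₗ σ.toLinearMap)

omit [Finite F] [Finite K] in
theorem qPoly_apply (σ : K ≃ₐ[F] K) (β γ y : K) :
    qPoly σ β γ y = β * σ y + γ * σ (σ y) := rfl

/-- The totally singular plane `K × 0` of the model. -/
def basePlane (Φ : (K × K) ≃ₗ[F] (Fin 6 → F)) : PG5 F :=
  LinearMap.range (Φ.toLinearMap ∘ₗ LinearMap.inl F K K)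

/-- The graph of a linear map, as a plane disjoint from `basePlane`. -/
def graphPlane (Φ : (K × K) ≃ₗ[F] (Fin 6 → F)) (A : K →ₗ[F] K) : PG5 F :=
  LinearMap.range (Φ.toLinearMap ∘ₗ A.prod LinearMap.id)

variable {Φ : (K × K) ≃ₗ[F] (Fin 6 → F)}

omit [Finite F] [Finite K] in
theorem mem_basePlane {x y : K} : Φ (x, y) ∈ basePlane Φ ↔ y = 0 := by
  constructor
  · rintro ⟨z, hz⟩
    have := Φ.injective hz
    exact (congrArg Prod.snd this).symm
  · rintro rfl
    exact ⟨x, rfl⟩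

omit [Finite F] [Finite K] in
theorem mem_graphPlane {A : K →ₗ[F] K} {x y : K} : Φ (x, y) ∈ graphPlane Φ A ↔ x = A y := by
  constructor
  · rintro ⟨z, hz⟩
    have := Φ.injective hz
    obtain ⟨rfl, rfl⟩ := Prod.mk.inj this
    rfl
  · rintro rfl
    exact ⟨y, rfl⟩

omit [Finite F] [Finite K] in
theorem isPlane_basePlane (h3 : finrank F K = 3) : IsPlane (basePlane Φ) := by
  rw [IsPlane, basePlane, LinearMap.finrank_range_of_inj, h3]
  exact Φ.injective.comp LinearMap.inl_injective

omit [Finite F] [Finite K] in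
theorem isPlane_graphPlane (h3 : finrank F K = 3) (A : K →ₗ[F] K) :
    IsPlane (graphPlane Φ A) := by
  rw [IsPlane, graphPlane, LinearMap.finrank_range_of_inj, h3]
  exact Φ.injective.comp fun x y h => congrArg Prod.snd h

omit [Finite F] [Finite K] in
theorem disjoint_graphPlane_basePlane (A : K →ₗ[F] K) :
    Disjoint (graphPlane Φ A) (basePlane Φ) := by
  rw [Submodule.disjoint_def]
  intro v hv hv'
  obtain ⟨⟨x, y⟩, rfl⟩ := Φ.surjective v
  rw [mem_graphPlane] at hv
  rw [mem_basePlane] at hv'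
  rw [hv, hv', map_zero, Prod.mk_zero_zero, map_zero]

omit [Finite F] [Finite K] in
theorem graphPlane_injective : Function.Injective (graphPlane Φ) := by
  intro A B h
  ext y
  rw [← mem_graphPlane (Φ := Φ), ← h, mem_graphPlane]

omit [Finite F] [Finite K] in
theorem onQuadric_basePlane (hΦ : ∀ u, kleinForm (Φ u) = Algebra.trace F K (u.1 * u.2)) :
    OnQuadric (basePlane Φ) := by
  intro v hv
  obtain ⟨⟨x, y⟩, rfl⟩ := Φ.surjective v
  rw [mem_basePlane] at hv
  rw [hΦ, hv, mul_zero, map_zero]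

omit [Finite F] [Finite K] in
theorem kleinBilin_model (hΦ : ∀ u, kleinForm (Φ u) = Algebra.trace F K (u.1 * u.2))
    (u v : K × K) : kleinBilin (Φ u) (Φ v) = Algebra.trace F K (u.1 * v.2 + v.1 * u.2) := by
  have h := kleinForm_add (Φ u) (Φ v)
  rw [← map_add, hΦ, hΦ, hΦ] at h
  simp only [Prod.fst_add, Prod.snd_add, add_mul, mul_add, map_add] at h ⊢
  linear_combination -h

variable {σ : K ≃ₐ[F] K} (hσ : ∀ x, σ (σ (σ x)) = x)
  (htr : ∀ x, algebraMap F K (Algebra.trace F K x) = x + σ x + σ (σ x))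
include hσ htr

omit [Finite F] [Finite K] in
-- With `δ = β + γ^q`, invariance of the trace under `σ` merges both terms into `Tr(δ y y^q)`. Thus
-- `δ` alone governs how the graph meets the quadric.
theorem algebraMap_trace_qPoly_mul (β γ y : K) :
    algebraMap F K (Algebra.trace F K (qPoly σ β γ y * y)) =
      (β + σ γ) * y * σ y + σ (β + σ γ) * σ y * σ (σ y) + σ (σ (β + σ γ)) * σ (σ y) * y := by
  rw [htr, qPoly_apply]
  simp only [map_mul, map_add, hσ]
  ring

omit [Finite F] [Finite K] in
theorem onQuadric_graphPlane_qPoly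
    (hΦ : ∀ u, kleinForm (Φ u) = Algebra.trace F K (u.1 * u.2)) {β γ : K}
    (h : β + σ γ = 0) : OnQuadric (graphPlane Φ (qPoly σ β γ)) := by
  intro v hv
  obtain ⟨⟨x, y⟩, rfl⟩ := Φ.surjective v
  rw [mem_graphPlane] at hv
  rw [hΦ, hv]
  apply (algebraMap F K).injective
  simp only
  rw [algebraMap_trace_qPoly_mul hσ htr, h]
  simp

theorem meetsInNondegenerateConic_graphPlane_qPoly (h3 : finrank F K = 3)
    (hΦ : ∀ u, kleinForm (Φ u) = Algebra.trace F K (u.1 * u.2)) {β γ : K}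
    (hd : β + σ γ ≠ 0) : MeetsInNondegenerateConic (graphPlane Φ (qPoly σ β γ)) := by
  refine ⟨isPlane_graphPlane h3 _, ?_⟩
  intro v hv hQ hB
  obtain ⟨⟨x, y⟩, rfl⟩ := Φ.surjective v
  rw [mem_graphPlane] at hv
  subst hv
  have hy : y = 0 := by
    -- Orthogonality to the whole graph says that this element is trace-orthogonal to every `z`. Its
    -- image under `σ` cancels two of the three terms of the form at `y`; the remaining product has
    -- a nonzero coefficient and forces `y = 0`, in any characteristic.
    have h1 : (β + σ γ) * σ y + σ (σ (β + σ γ)) * σ (σ y) = 0 := by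
      refine eq_zero_of_trace_mul_eq_zero (F := F) fun z => ?_
      have h2 := hB (Φ (qPoly σ β γ z, z)) (mem_graphPlane.2 rfl)
      rw [polar_kleinForm, kleinBilin_model hΦ] at h2
      rw [← h2]
      apply (algebraMap F K).injective
      rw [htr, htr]
      simp only [qPoly_apply, map_mul, map_add, hσ]
      ring
    have h2 := congrArg σ h1
    rw [hΦ] at hQ
    have h0 := algebraMap_trace_qPoly_mul (F := F) hσ htr β γ y
    simp only at hQ
    rw [hQ, map_zero] at h0
    simp only [map_mul, map_add, hσ, map_zero] at h0 h2
    have h4 : σ (σ (β + σ γ)) * σ (σ y) * y = 0 := by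
      simp only [map_add, hσ]
      linear_combination -h0 - σ y * h2
    have h5 : σ (σ (β + σ γ)) ≠ 0 := fun h => hd (σ.injective (σ.injective (by simpa using h)))
    have h6 := (mul_eq_zero.1 h4).imp_left fun h => (mul_eq_zero.1 h).resolve_left h5
    exact h6.elim (fun h => σ.injective (σ.injective (by simpa using h))) id
  rw [hy, map_zero, Prod.mk_zero_zero, map_zero]

omit hσ htr [Finite F] [Finite K] in
theorem exists_apply_ne (h3 : finrank F K = 3) (hfix : ∀ x, σ x = x → ∃ a, algebraMap F K a = x) :
    ∃ x, σ x ≠ x := by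
  by_contra! h
  have : (⊥ : Subalgebra F K) = ⊤ := by
    rw [eq_top_iff]
    intro x _
    obtain ⟨a, ha⟩ := hfix x (h x)
    exact Algebra.mem_bot.2 ⟨a, ha⟩
  have h1 := Subalgebra.bot_eq_top_iff_finrank_eq_one.1 this
  omega

omit htr hσ [Finite F] [Finite K] in
-- Evaluation at `1` and at an `x` not fixed by `σ` gives a linear system for the coefficients with
-- nonzero determinant `x^(q^2) - x^q`, up to sign.
theorem qPoly_injective (h3 : finrank F K = 3)
    (hfix : ∀ x, σ x = x → ∃ a, algebraMap F K a = x) :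
    Function.Injective fun p : K × K => qPoly σ p.1 p.2 := by
  rintro ⟨β, γ⟩ ⟨β', γ'⟩ h
  have h1 := LinearMap.congr_fun h 1
  obtain ⟨x, hx⟩ := exists_apply_ne h3 hfix
  have h2 := LinearMap.congr_fun h x
  simp only [qPoly_apply, map_one, mul_one] at h1 h2
  have h4 : σ x - σ (σ x) ≠ 0 := sub_ne_zero.2 fun e => hx (σ.injective e).symm
  have h5 : (β - β') * (σ x - σ (σ x)) = 0 := by linear_combination h2 - σ (σ x) * h1
  have h6 : β = β' := sub_eq_zero.1 ((mul_eq_zero.1 h5).resolve_right h4)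
  rw [h6, add_right_inj] at h1
  rw [h6, h1]

/-- The planes that are graphs of `y ↦ β y^q + γ y^(q^2)` and do not lie on the quadric. -/
def gabidulinPlanes (Φ : (K × K) ≃ₗ[F] (Fin 6 → F)) (σ : K ≃ₐ[F] K) : Set (PG5 F) :=
  {α | ∃ β γ : K, β + σ γ ≠ 0 ∧ α = graphPlane Φ (qPoly σ β γ)}

omit htr hσ [Finite F] in
-- The admissible pairs are `K × K` without the graph of `γ ↦ -γ^q`, and `|K| = q^3`.
theorem ncard_gabidulinPlanes (h3 : finrank F K = 3)
    (hfix : ∀ x, σ x = x → ∃ a, algebraMap F K a = x) :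
    (gabidulinPlanes Φ σ).ncard = Nat.card F ^ 6 - Nat.card F ^ 3 := by
  have h1 : gabidulinPlanes Φ σ = (fun p : K × K => graphPlane Φ (qPoly σ p.1 p.2)) ''
      (Set.range fun γ : K => (-σ γ, γ))ᶜ := by
    ext α
    constructor
    · rintro ⟨β, γ, h, rfl⟩
      refine ⟨(β, γ), ?_, rfl⟩
      rintro ⟨γ', h'⟩
      obtain ⟨rfl, rfl⟩ := Prod.mk.inj h'
      exact h (neg_add_cancel _)
    · rintro ⟨⟨β, γ⟩, h, rfl⟩
      refine ⟨β, γ, fun h' => h ⟨γ, ?_⟩, rfl⟩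
      rw [eq_neg_of_add_eq_zero_left h']
  have hcard : Nat.card K = Nat.card F ^ 3 := by rw [← h3, ← Module.natCard_eq_pow_finrank]
  have hinj : Function.Injective fun p : K × K => graphPlane Φ (qPoly σ p.1 p.2) :=
    graphPlane_injective.comp (qPoly_injective h3 hfix)
  rw [h1, Set.ncard_image_of_injective _ hinj,
    Set.ncard_compl, ← Set.image_univ, Set.ncard_image_of_injective _
      (fun x y h => congrArg Prod.snd h), Set.ncard_univ, Nat.card_prod, hcard]
  ring_nf

omit htr hσ [Finite F] [Finite K] in
/-- A line disjoint from `basePlane` lies in the graph of some `y ↦ β y^q + γ y^(q^2)`. -/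
theorem exists_le_graphPlane_qPoly (hfix : ∀ x, σ x = x → ∃ a, algebraMap F K a = x)
    {l : PG5 F} (hl : IsLine l) (hd : Disjoint l (basePlane Φ)) :
    ∃ β γ, l ≤ graphPlane Φ (qPoly σ β γ) := by
  have : Module.Finite F l := Module.finite_of_finrank_pos (by rw [hl]; norm_num)
  let b := finBasisOfFinrankEq F l hl
  obtain ⟨⟨x₁, y₁⟩, h1⟩ := Φ.surjective (b 0)
  obtain ⟨⟨x₂, y₂⟩, h2⟩ := Φ.surjective (b 1)
  -- As `l` misses `K × 0`, its second projection is injective, so `y₁, y₂` are independent over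
  -- `F`.
  have hind : ∀ a a' : F, a • y₁ + a' • y₂ = 0 → a = 0 ∧ a' = 0 := by
    intro a a' h
    have h4 : a • b 0 + a' • b 1 = 0 := by
      apply Subtype.ext
      refine Submodule.disjoint_def.1 hd _ (Subtype.property _) ?_
      have : ((a • b 0 + a' • b 1 : l) : Fin 6 → F) = Φ (a • x₁ + a' • x₂, a • y₁ + a' • y₂) := by
        rw [Submodule.coe_add, Submodule.coe_smul, Submodule.coe_smul, ← h1, ← h2, ← map_smul,
          ← map_smul, ← map_add]
        rfl
      rw [this, mem_basePlane, h]
    have h5 := Fintype.linearIndependent_iff.1 b.linearIndependent ![a, a'] (by simpa using h4)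
    exact ⟨h5 0, h5 1⟩
  have hy₁ : y₁ ≠ 0 := fun h => one_ne_zero (hind 1 0 (by simp [h])).1
  -- If this determinant vanished, `y₂ / y₁` would be fixed by `σ` and so lie in `F`. Cramer's rule
  -- then gives the coefficients below.
  have hD : σ y₁ * σ (σ y₂) - σ (σ y₁) * σ y₂ ≠ 0 := by
    rw [← map_mul, ← map_mul, ← map_sub]
    intro h
    rw [map_eq_zero_iff _ σ.injective, sub_eq_zero] at h
    obtain ⟨a, ha⟩ := hfix (y₂ / y₁) (by
      rw [map_div₀, div_eq_div_iff (by simpa using hy₁) hy₁, mul_comm, h, mul_comm])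
    have := (hind a (-1) (by
      rw [Algebra.smul_def, ha, div_mul_cancel₀ _ hy₁, neg_one_smul, add_neg_cancel])).2
    simp at this
  refine ⟨(x₁ * σ (σ y₂) - x₂ * σ (σ y₁)) / (σ y₁ * σ (σ y₂) - σ (σ y₁) * σ y₂),
    (σ y₁ * x₂ - σ y₂ * x₁) / (σ y₁ * σ (σ y₂) - σ (σ y₁) * σ y₂), ?_⟩
  intro v hv
  have hv' : v = (b.repr ⟨v, hv⟩ 0) • Φ (x₁, y₁) + (b.repr ⟨v, hv⟩ 1) • Φ (x₂, y₂) := by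
    have := congrArg Subtype.val (b.sum_repr ⟨v, hv⟩)
    rw [Fin.sum_univ_two] at this
    rw [h1, h2]
    exact this.symm
  rw [hv']
  refine Submodule.add_mem _ (Submodule.smul_mem _ _ ?_) (Submodule.smul_mem _ _ ?_) <;>
  · rw [mem_graphPlane, qPoly_apply]
    rw [div_mul_eq_mul_div, div_mul_eq_mul_div, ← add_div, eq_div_iff hD]
    ring

theorem isFamilyX_gabidulinPlanes (h3 : finrank F K = 3)
    (hΦ : ∀ u, kleinForm (Φ u) = Algebra.trace F K (u.1 * u.2))
    (hfix : ∀ x, σ x = x → ∃ a, algebraMap F K a = x) :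
    IsFamilyX (basePlane Φ) (gabidulinPlanes Φ σ) where
  card := ncard_gabidulinPlanes h3 hfix
  disj := by
    rintro _ ⟨β, γ, -, rfl⟩
    exact disjoint_graphPlane_basePlane _
  conic := by
    rintro _ ⟨β, γ, hd, rfl⟩
    exact meetsInNondegenerateConic_graphPlane_qPoly hσ htr h3 hΦ hd
  covers := by
    intro l hl h
    have hg := isPlane_basePlane (Φ := Φ) h3
    have hQ := onQuadric_basePlane hΦ
    -- Quadric lines, including those disjoint from `g`, are left to `𝒴`. Any other line lies in a
    -- graph, and that graph has `β + γ^q ≠ 0`, since otherwise it would put the line on the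
    -- quadric.
    by_cases hlQ : OnQuadric l
    · have hlg : ¬ l ≤ basePlane Φ := by
        rcases h with h | h
        · intro hle
          rw [disjoint_of_le_iff_left_eq_bot hle] at h
          rw [h, IsLine, finrank_bot] at hl
          omega
        · exact h.2
      obtain ⟨α, hα, hle⟩ := exists_familyY_ge hg hQ hl hlQ hlg
      exact ⟨α, Or.inr hα, hle⟩
    · obtain ⟨β, γ, hle⟩ := exists_le_graphPlane_qPoly hfix hl
        (h.resolve_right fun h => hlQ h.1)
      refine ⟨_, Or.inl ⟨β, γ, fun hd => hlQ ?_, rfl⟩, hle⟩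
      exact (onQuadric_graphPlane_qPoly hσ htr hΦ hd).mono hle

end CubicExtension

/-! ### The multiplicative group of `K` as a Singer group. -/

section Singer
variable {F K : Type*} [Field F] [Field K] [Algebra F K]

/-- The similarity `(x, y) ↦ (ω x, ω⁻¹ y)` of the model, for `ω` in the multiplicative group. -/
def singerHom (Φ : (K × K) ≃ₗ[F] (Fin 6 → F)) : Kˣ →* ((Fin 6 → F) ≃ₗ[F] (Fin 6 → F)) where
  toFun ω := Φ.symm ≪≫ₗ
    (LinearEquiv.prodCongr (DistribMulAction.toLinearEquiv F K ω)
      (DistribMulAction.toLinearEquiv F K ω⁻¹)) ≪≫ₗ Φ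
  map_one' := by
    ext x i
    simp
  map_mul' ω ω' := by
    ext x i
    simp [mul_smul, smul_comm ω⁻¹ ω'⁻¹]

theorem singerHom_apply (Φ : (K × K) ≃ₗ[F] (Fin 6 → F)) (ω : Kˣ) (x y : K) :
    singerHom Φ ω (Φ (x, y)) = Φ (ω * x, (ω : K)⁻¹ * y) := by
  simp [singerHom, Units.smul_def]

variable {Φ : (K × K) ≃ₗ[F] (Fin 6 → F)}

/-- The subspace of `basePlane` that corresponds to a subspace of `K`. -/
def basePart (Φ : (K × K) ≃ₗ[F] (Fin 6 → F)) (W : Submodule F K) : PG5 F :=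
  W.map (Φ.toLinearMap ∘ₗ LinearMap.inl F K K)

theorem mem_basePart {W : Submodule F K} {x y : K} :
    Φ (x, y) ∈ basePart Φ W ↔ x ∈ W ∧ y = 0 := by
  constructor
  · rintro ⟨z, hz, h⟩
    obtain ⟨rfl, rfl⟩ := Prod.mk.inj (Φ.injective h)
    exact ⟨hz, rfl⟩
  · rintro ⟨hx, rfl⟩
    exact ⟨x, hx, rfl⟩

theorem exists_eq_basePart {P : PG5 F} (hP : P ≤ basePlane Φ) :
    ∃ W : Submodule F K, P = basePart Φ W ∧ finrank F W = finrank F P := by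
  have hinj : Function.Injective (Φ.toLinearMap ∘ₗ LinearMap.inl F K K) :=
    Φ.injective.comp LinearMap.inl_injective
  have h : P = basePart Φ (P.comap (Φ.toLinearMap ∘ₗ LinearMap.inl F K K)) :=
    (Submodule.map_comap_eq_of_le hP).symm
  refine ⟨_, h, ?_⟩
  conv_rhs => rw [h]
  exact (Submodule.equivMapOfInjective _ hinj _).finrank_eq

theorem move_singerHom_basePart_eq_iff {ω : Kˣ} {W W' : Submodule F K} :
    move (singerHom Φ ω) (basePart Φ W) = basePart Φ W' ↔ ∀ x, (ω : K)⁻¹ * x ∈ W ↔ x ∈ W' := by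
  have hsymm : ∀ x y, (singerHom Φ ω).symm (Φ (x, y)) = Φ ((ω : K)⁻¹ * x, (ω : K) * y) := by
    intro x y
    rw [LinearEquiv.symm_apply_eq, singerHom_apply]
    simp
  constructor
  · intro h x
    have h1 := mem_basePart (Φ := Φ) (W := W') (x := x) (y := 0)
    rw [← h, mem_move, hsymm, mem_basePart] at h1
    simpa using h1
  · intro h
    ext v
    obtain ⟨⟨x, y⟩, rfl⟩ := Φ.surjective v
    rw [mem_move, hsymm, mem_basePart, mem_basePart, h]
    simp

theorem mem_smul_iff_of_scalar {a : F} {x : K} {W : Submodule F K} (h : algebraMap F K a ≠ 0) :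
    (algebraMap F K a)⁻¹ * x ∈ W ↔ x ∈ W := by
  have ha : a⁻¹ ≠ 0 := inv_ne_zero fun h' => h (by rw [h', map_zero])
  rw [← map_inv₀, ← Algebra.smul_def, W.smul_mem_iff ha]

/-- A multiplication that is scalar on `K` fixes every subspace of `basePlane`. -/
theorem move_singerHom_eq_self_of_scalar {ω : Kˣ} {a : F} (ha : algebraMap F K a = ω) {P : PG5 F}
    (hP : P ≤ basePlane Φ) : move (singerHom Φ ω) P = P := by
  obtain ⟨W, rfl, -⟩ := exists_eq_basePart hP
  rw [move_singerHom_basePart_eq_iff]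
  intro x
  rw [← ha]
  exact mem_smul_iff_of_scalar (ha ▸ ω.ne_zero)

/-- A plane of a cubic extension is the set of solutions of a linear equation `Tr(ax) = 0`. -/
theorem exists_trace_equation [Finite F] [Finite K] (h3 : finrank F K = 3) {W : Submodule F K}
    (hW : finrank F W = 2) : ∃ a : K, a ≠ 0 ∧ (∀ x, x ∈ W ↔ Algebra.trace F K (a * x) = 0) ∧
      ∀ b, (∀ x ∈ W, Algebra.trace F K (b * x) = 0) → ∃ t : F, b = algebraMap F K t * a := by
  have hnd := traceForm_nondegenerate F K
  have hrefl : (Algebra.traceForm F K).IsRefl := (Algebra.traceForm_isSymm F).isRefl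
  have h1 : finrank F ((Algebra.traceForm F K).orthogonal W) = 1 := by
    rw [LinearMap.BilinForm.finrank_orthogonal hnd, h3, hW]
  obtain ⟨⟨a, ha⟩, hne, hspan⟩ := finrank_eq_one_iff'.1 h1
  have hb : ∀ b, (∀ x ∈ W, Algebra.trace F K (b * x) = 0) → ∃ t : F, b = algebraMap F K t * a := by
    intro b hb
    obtain ⟨t, ht⟩ := hspan ⟨b, fun x hx => by
      change Algebra.trace F K (x * b) = 0
      rw [mul_comm]
      exact hb x hx⟩
    refine ⟨t, ?_⟩
    rw [← Algebra.smul_def]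
    exact (congrArg Subtype.val ht).symm
  refine ⟨a, fun h => hne (Subtype.ext h), fun x => ⟨fun hx => ?_, fun hx => ?_⟩, hb⟩
  · rw [mul_comm]
    exact ha x hx
  · rw [← LinearMap.BilinForm.orthogonal_orthogonal hnd hrefl W]
    intro b hbW
    obtain ⟨t, rfl⟩ := hb b fun x hx => by
      rw [mul_comm]
      exact hbW x hx
    change Algebra.trace F K (algebraMap F K t * a * x) = 0
    rw [mul_assoc, ← Algebra.smul_def, map_smul, hx, smul_zero]

/-- On `K × 0` the action is multiplication by the cyclic group `Kˣ`. Quotients of generators make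
it transitive on points; on lines `Tr(ax) = 0` it acts by `a ↦ a/ω`. In both cases a stabilizer
consists of scalars from `F`, which act trivially on the plane. -/
theorem isSingerGroup_range_singerHom [Finite F] [Finite K] (h3 : finrank F K = 3)
    (hΦ : ∀ u, kleinForm (Φ u) = Algebra.trace F K (u.1 * u.2)) :
    IsSingerGroup (basePlane Φ) (singerHom Φ).range where
  quadric := by
    rintro _ ⟨ω, rfl⟩ v
    obtain ⟨⟨x, y⟩, rfl⟩ := Φ.surjective v
    rw [singerHom_apply, hΦ, hΦ]
    have : (ω : K) * x * ((ω : K)⁻¹ * y) = x * y := by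
      rw [mul_mul_mul_comm, mul_inv_cancel₀ ω.ne_zero, one_mul]
    simp only [this]
  plane := by
    rintro _ ⟨ω, rfl⟩
    obtain ⟨W, hW, -⟩ := exists_eq_basePart (le_refl (basePlane Φ))
    have hW' : ∀ x, x ∈ W := fun x => by
      have h : Φ (x, 0) ∈ basePlane Φ := mem_basePlane.2 rfl
      rw [hW, mem_basePart] at h
      exact h.1
    rw [hW, move_singerHom_basePart_eq_iff]
    exact fun x => ⟨fun _ => hW' _, fun _ => hW' _⟩
  cyclic := by
    obtain ⟨ω₀, hω₀⟩ := IsCyclic.exists_generator (α := Kˣ)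
    refine ⟨singerHom Φ ω₀, ⟨ω₀, rfl⟩, ?_⟩
    rintro _ ⟨ω, rfl⟩
    obtain ⟨k, rfl⟩ := hω₀ ω
    refine ⟨k, fun P _ _ => ?_⟩
    simp only [map_zpow]
  point_transitive := by
    intro P P' hP hPg hP' hPg'
    obtain ⟨W, rfl, hW⟩ := exists_eq_basePart hPg
    obtain ⟨W', rfl, hW'⟩ := exists_eq_basePart hPg'
    obtain ⟨⟨x, hx⟩, hx0, hxs⟩ := finrank_eq_one_iff'.1 (hW.trans hP)
    obtain ⟨⟨x', hx'⟩, hx0', hxs'⟩ := finrank_eq_one_iff'.1 (hW'.trans hP')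
    have hne : x ≠ 0 := fun h => hx0 (Subtype.ext h)
    have hne' : x' ≠ 0 := fun h => hx0' (Subtype.ext h)
    refine ⟨_, ⟨Units.mk0 (x' / x) (div_ne_zero hne' hne), rfl⟩, ?_⟩
    rw [move_singerHom_basePart_eq_iff]
    intro z
    rw [Units.val_mk0]
    constructor
    · intro hz
      obtain ⟨t, ht⟩ := hxs ⟨_, hz⟩
      have ht' : t • x = (x' / x)⁻¹ * z := congrArg Subtype.val ht
      have : z = t • x' := by
        rw [Algebra.smul_def] at ht' ⊢
        field_simp at ht'
        linear_combination -ht'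
      rw [this]
      exact W'.smul_mem t hx'
    · intro hz
      obtain ⟨t, ht⟩ := hxs' ⟨_, hz⟩
      have ht' : t • x' = z := congrArg Subtype.val ht
      have : (x' / x)⁻¹ * z = t • x := by
        rw [← ht', Algebra.smul_def, Algebra.smul_def]
        field_simp
      rw [this]
      exact W.smul_mem t hx
  point_free := by
    rintro _ ⟨ω, rfl⟩ P hP hPg h P' - hPg'
    obtain ⟨W, rfl, hW⟩ := exists_eq_basePart hPg
    obtain ⟨⟨x, hx⟩, hx0, hxs⟩ := finrank_eq_one_iff'.1 (hW.trans hP)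
    have hne : x ≠ 0 := fun h => hx0 (Subtype.ext h)
    rw [move_singerHom_basePart_eq_iff] at h
    have hωx : (ω : K) * x ∈ W := by
      rw [← h, inv_mul_cancel_left₀ ω.ne_zero]
      exact hx
    obtain ⟨t, ht⟩ := hxs ⟨_, hωx⟩
    have ht' : t • x = (ω : K) * x := congrArg Subtype.val ht
    rw [Algebra.smul_def] at ht'
    exact move_singerHom_eq_self_of_scalar (mul_right_cancel₀ hne ht') hPg'
  line_transitive := by
    intro l l' hl hlg hl' hlg'
    obtain ⟨W, rfl, hW⟩ := exists_eq_basePart hlg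
    obtain ⟨W', rfl, hW'⟩ := exists_eq_basePart hlg'
    obtain ⟨a, ha, haW, -⟩ := exists_trace_equation h3 (hW.trans hl)
    obtain ⟨a', ha', haW', -⟩ := exists_trace_equation h3 (hW'.trans hl')
    refine ⟨_, ⟨Units.mk0 (a / a') (div_ne_zero ha ha'), rfl⟩, ?_⟩
    rw [move_singerHom_basePart_eq_iff]
    intro x
    rw [haW, haW', Units.val_mk0]
    have : a * ((a / a')⁻¹ * x) = a' * x := by field_simp
    rw [this]
  line_free := by
    rintro _ ⟨ω, rfl⟩ l hl hlg h P' - hPg'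
    obtain ⟨W, rfl, hW⟩ := exists_eq_basePart hlg
    obtain ⟨a, ha, haW, hab⟩ := exists_trace_equation h3 (hW.trans hl)
    rw [move_singerHom_basePart_eq_iff] at h
    -- If `ω` fixes the line, `a` and `aω` define the same line, so they differ by a factor in `F`,
    -- and `ω` is that factor.
    obtain ⟨t, ht⟩ := hab (a * ω) fun x hx => by
      rw [mul_assoc, ← haW, ← h, inv_mul_cancel_left₀ ω.ne_zero]
      exact hx
    refine move_singerHom_eq_self_of_scalar (a := t) ?_ hPg'
    rw [mul_comm] at ht
    exact (mul_right_cancel₀ ha ht).symm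

end Singer

/-! ### Existence of the data, and the theorem. -/

theorem exists_isDesignData (F : Type*) [Field F] [Finite F] :
    ∃ (g l P : PG5 F) (C : Subgroup ((Fin 6 → F) ≃ₗ[F] (Fin 6 → F))) (X : Set (PG5 F)),
      IsDesignData g l P C X := by
  obtain ⟨K, _, _, _, σ, h3, hσ, htr, hfix⟩ := exists_cubic_extension F
  obtain ⟨Φ, hΦ⟩ := exists_trace_model h3
  have hg := isPlane_basePlane (Φ := Φ) h3
  obtain ⟨v, hv, hne⟩ := (basePlane Φ).exists_mem_ne_zero_of_ne_bot (by
    intro h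
    rw [h, IsPlane, finrank_bot] at hg
    omega)
  have hP : IsPoint (F ∙ v) := finrank_span_singleton hne
  obtain ⟨l, hl, hPl, hlg⟩ := exists_isLine_between hg hP
    ((Submodule.span_singleton_le_iff_mem _ _).2 hv)
  exact ⟨basePlane Φ, l, F ∙ v, (singerHom Φ).range, gabidulinPlanes Φ σ,
    { plane := hg
      onQuadric := onQuadric_basePlane hΦ
      line := hl
      line_le := hlg
      point := hP
      point_le := hPl
      singer := isSingerGroup_range_singerHom h3 hΦ
      familyX := isFamilyX_gabidulinPlanes hσ htr h3 hΦ hfix }⟩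

end KleinCover

theorem theorem3p2 (F : Type*) [Field F] [Finite F] :
    (∃ (g l P : KleinCover.PG5 F) (C : Subgroup ((Fin 6 → F) ≃ₗ[F] (Fin 6 → F)))
      (X : Set (KleinCover.PG5 F)), KleinCover.IsDesignData g l P C X) ∧
    ∀ (g l P : KleinCover.PG5 F) (C : Subgroup ((Fin 6 → F) ≃ₗ[F] (Fin 6 → F)))
      (X : Set (KleinCover.PG5 F)), KleinCover.IsDesignData g l P C X →
      (∃ Γ : KleinCover.PG5 F, KleinCover.IsHyperplane Γ ∧ g ≤ Γ) ∧
      ∀ Γ : KleinCover.PG5 F, KleinCover.IsHyperplane Γ → g ≤ Γ →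
        {α ∈ KleinCover.design g l P C X | α ≤ Γ}.ncard =
          Nat.card F ^ 3 + 2 * Nat.card F ^ 2 + Nat.card F - 1 := by
  refine ⟨KleinCover.exists_isDesignData F, fun g l P C X h => ⟨?_, fun Γ hΓ hgΓ => ?_⟩⟩
  · exact KleinCover.exists_isHyperplane_ge h.plane h.onQuadric
  · exact KleinCover.ncard_design_hyperplane h hΓ hgΓ
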